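/- A projective space $(\mathcal P,\mathcal L)$ consists of a set $\mathcal P$ of points and a set $\mathcal L$ of lines (subsets of $\mathcal P$) such that any two distinct points lie on exactly one line, the Veblen--Young axiom holds, and each line has at least three points; it is desarguesian if Desargues' theorem holds in it. A subspace is a set of points that contains with any two distinct points the line joining them; $\mathcal X\vee\mathcal Y$ denotes the least subspace containing $\mathcal X\cup\mathcal Y$. Mappings $\varphi:\mathcal P\rightharpoonup\mathcal P'$ may be partially defined, with domain $\operatorname{dom}\varphi\subseteq\mathcal P$, and $\mathcal M^\varphi:=\{X^\varphi\mid X\in\mathcal M\cap\operatorname{dom}\varphi\}$ for $\mathcal M\subseteq\mathcal P$. Such a mapping of projective spaces is called - weak linear, if $(\{X\}\vee\{Y\})^\varphi\subseteq\{X\}^\varphi\vee\{Y\}^\varphi$ for all $X,Y\in\mathcal P$ with $X\neq Y$; - linear, if $(\{X\}\vee\{Y\})^\varphi=\{X\}^\varphi\vee\{Y\}^\varphi$ for all $X,Y\in\mathcal P$ with $X\neq Y$, and whenever $X^\varphi=Y^\varphi$ for distinct $X,Y\in\operatorname{dom}\varphi$, some point of the line $\{X\}\vee\{Y\}$ is not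 in $\operatorname{dom}\varphi$; - a strong embedding, if it is globally defined and injective, preserves both collinearity and non-collinearity of points, and maps every independent set of points (no point of which is in the least subspace containing the others) to an independent set. Theorem. Let $(\mathcal P,\mathcal L)$ and $(\mathcal P',\mathcal L')$ be desarguesian projective spaces, of arbitrary dimensions, and let $\varphi:\mathcal P\rightharpoonup\mathcal P'$ be a weak linear mapping whose image contains a triangle, i.e. three non-collinear points. Then there exist a projective space $(\mathcal P'',\mathcal L'')$, a strong embedding $\iota:\mathcal P\to\mathcal P''$ and a linear mapping $\psi:\mathcal P''\rightharpoonup\mathcal P'$ such that $\varphi$ is the product of $\iota$ and $\psi$: for each $X\in\mathcal P$ we have $X\in\operatorname{dom}\varphi$ if and only if $X^\iota\in\operatorname{dom}\psi$, and in this case $X^\varphi=(X^\iota)^\psi$. -/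

import Mathlib

universe u v

/-- A projective space with point set `P`: a set of lines (each line being a set of points) such
that any two distinct points are on exactly one line, the axiom of Veblen and Young holds, and each
line has at least three points.  There is no restriction on the dimension. -/
structure ProjectiveSpace (P : Type*) where
  /-- The set of lines. -/
  lines : Set (Set P)
  exists_unique_line : ∀ x y : P, x ≠ y → ∃! l : Set P, l ∈ lines ∧ x ∈ l ∧ y ∈ l
  /-- If `a, b, c, d` are distinct points and the line `ab` meets the line `cd`, then the line `ac`
  meets the line `bd`. -/
  veblen_young : ∀ a b c d : P, a ≠ b → a ≠ c → a ≠ d → b ≠ c → b ≠ d → c ≠ d →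
    ∀ ab ∈ lines, ∀ cd ∈ lines, ∀ ac ∈ lines, ∀ bd ∈ lines,
      a ∈ ab → b ∈ ab → c ∈ cd → d ∈ cd → a ∈ ac → c ∈ ac → b ∈ bd → d ∈ bd →
      (ab ∩ cd).Nonempty → (ac ∩ bd).Nonempty
  three_points : ∀ l ∈ lines, ∃ x ∈ l, ∃ y ∈ l, ∃ z ∈ l, x ≠ y ∧ x ≠ z ∧ y ≠ z

namespace ProjectiveSpace

/-- A set of points is collinear if some line contains it, or if it has at most one element. -/
def Collinear {P : Type*} (S : ProjectiveSpace P) (M : Set P) : Prop :=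
  M.Subsingleton ∨ ∃ l ∈ S.lines, M ⊆ l

/-- A subspace contains each line that joins two distinct points of it. -/
def IsSubspace {P : Type*} (S : ProjectiveSpace P) (T : Set P) : Prop :=
  ∀ x ∈ T, ∀ y ∈ T, x ≠ y → ∀ l ∈ S.lines, x ∈ l → y ∈ l → l ⊆ T

/-- The least subspace containing `M`. -/
def span {P : Type*} (S : ProjectiveSpace P) (M : Set P) : Set P :=
  ⋂₀ {T : Set P | S.IsSubspace T ∧ M ⊆ T}

/-- The join `M ∨ N`, the least subspace containing `M` and `N`. -/
def join {P : Type*} (S : ProjectiveSpace P) (M N : Set P) : Set P :=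
  S.span (M ∪ N)

/-- A set of points is independent if none of its points is in the span of the others. -/
def Independent {P : Type*} (S : ProjectiveSpace P) (M : Set P) : Prop :=
  ∀ x ∈ M, x ∉ S.span (M \ {x})

/-- Desargues' theorem holds: if the triangles `a₁ a₂ a₃` and `b₁ b₂ b₃` are in perspective from
`o`, where `aᵢ ≠ bᵢ`, no three of `o, a₁, a₂, a₃` are collinear, and no three of `o, b₁, b₂, b₃`
are collinear, then the common points of corresponding sides are collinear. -/
def IsDesarguesian {P : Type*} (S : ProjectiveSpace P) : Prop :=
  ∀ o a₁ a₂ a₃ b₁ b₂ b₃ p₁₂ p₁₃ p₂₃ : P,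
    S.Collinear {o, a₁, b₁} → S.Collinear {o, a₂, b₂} → S.Collinear {o, a₃, b₃} →
    a₁ ≠ b₁ → a₂ ≠ b₂ → a₃ ≠ b₃ →
    ¬ S.Collinear {o, a₁, a₂} → ¬ S.Collinear {o, a₁, a₃} → ¬ S.Collinear {o, a₂, a₃} →
    ¬ S.Collinear {a₁, a₂, a₃} →
    ¬ S.Collinear {o, b₁, b₂} → ¬ S.Collinear {o, b₁, b₃} → ¬ S.Collinear {o, b₂, b₃} →
    ¬ S.Collinear {b₁, b₂, b₃} →
    S.Collinear {a₁, a₂, p₁₂} → S.Collinear {b₁, b₂, p₁₂} →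
    S.Collinear {a₁, a₃, p₁₃} → S.Collinear {b₁, b₃, p₁₃} →
    S.Collinear {a₂, a₃, p₂₃} → S.Collinear {b₂, b₃, p₂₃} →
    S.Collinear {p₁₂, p₁₃, p₂₃}

/-- The set `M` contains a triangle, i.e. three non-collinear points. -/
def ContainsTriangle {P : Type*} (S : ProjectiveSpace P) (M : Set P) : Prop :=
  ∃ x ∈ M, ∃ y ∈ M, ∃ z ∈ M, ¬ S.Collinear {x, y, z}

/-- Weak linear mappings. A partially defined mapping is a `PFun`, and `φ.image M` is the set of
all images of points in `M ∩ φ.Dom`. -/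
def IsWeakLinear {P P' : Type*} (S : ProjectiveSpace P) (S' : ProjectiveSpace P')
    (φ : P →. P') : Prop :=
  ∀ x y : P, x ≠ y → φ.image (S.join {x} {y}) ⊆ S'.join (φ.image {x}) (φ.image {y})

/-- Linear mappings. -/
structure IsLinear {P P' : Type*} (S : ProjectiveSpace P) (S' : ProjectiveSpace P')
    (φ : P →. P') : Prop where
  image_join : ∀ x y : P, x ≠ y →
    φ.image (S.join {x} {y}) = S'.join (φ.image {x}) (φ.image {y})
  exists_exceptional : ∀ x ∈ φ.Dom, ∀ y ∈ φ.Dom, x ≠ y → φ x = φ y →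
    ∃ z ∈ S.join {x} {y}, z ∉ φ.Dom

/-- Embeddings: globally defined injective mappings preserving collinearity and
non-collinearity of points. -/
structure IsEmbedding {P P' : Type*} (S : ProjectiveSpace P) (S' : ProjectiveSpace P')
    (f : P → P') : Prop where
  injective : Function.Injective f
  collinear : ∀ x y z : P, S.Collinear {x, y, z} → S'.Collinear {f x, f y, f z}
  not_collinear : ∀ x y z : P, ¬ S.Collinear {x, y, z} → ¬ S'.Collinear {f x, f y, f z}

/-- Strong embeddings: independent points always go over to independent points. -/
structure IsStrongEmbedding {P P' : Type*} (S : ProjectiveSpace P) (S' : ProjectiveSpace P')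
    (f : P → P') : Prop extends IsEmbedding S S' f where
  independent : ∀ M : Set P, S.Independent M → S'.Independent (f '' M)

end ProjectiveSpace

/-!
Both spaces get homogeneous coordinates, the mapping `φ` turns out to come from a semilinear map
`F : V → V'` with respect to a homomorphism `σ : K → K'` of division rings, and such a map factors
through the extension of scalars of `V` along `σ`.

*Coordinates* (`exists_coordinates`). Let `H` be a hyperplane, which exists by Zorn's lemma. By
Desargues' theorem all conceivable dilations of the complement of `H` exist
(`exists_isDilation`): such a dilation is forced off the line through its centre on which it is
prescribed, Desargues' theorem says that the forced values are consistent (`Persp.trans`), and an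
auxiliary pair of points gives the values on that line. The translations form an abelian group `V`
that acts regularly on the complement of `H` (`exists_addCommGroup`). The endomorphisms of `V` that
preserve all directions are a division ring `K`, since homotheties make it transitive on the
translations of a given direction (`exists_divisionRing`). The points of the space then correspond
to the one-dimensional subspaces of `V × K`, the points of `H` being those of `V × 0`.

*Fundamental theorem* (`IsProjectiveMap.exists_semilinearMap`). On vectors, `φ` is a map `g` to
subspaces of dimension at most one with `g (v + w) ≤ g v ⊔ g w`. Fix a non-zero `a' ∈ g a`. If
`g x` is not contained in `g a`, then there is just one `f x ∈ g x` with `a' + f x ∈ g (a + x)`.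
This is additive on points in general position, and `x ↦ f (x + b) - f b` is its additive extension
to all vectors; it does not depend on `b`, because the image is not contained in a line. Its behaviour
on multiples of vectors defines `σ`.

*Factorization.* With a basis `b` of `V` indexed by `I`, let the second space be that of the vector
space `I →₀ K'`. Applying `σ` to coordinates gives a strong embedding, because each linear
functional on `V` extends along `σ`, so that linear independence is preserved
(`extendScalars_mem_span_iff`). The linear map that sends the `i`-th unit vector to `F (b i)` gives
a linear mapping (`isLinear_ofLinearMap`), and the product of the two is `φ`.
-/

namespace ProjectiveSpace

variable {P : Type*} (S : ProjectiveSpace P)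

/-! ### Incidence -/

/-- Three points, not necessarily distinct, that are collinear. -/
def Col (x y z : P) : Prop := S.Collinear {x, y, z}

variable {S}

theorem Col.left_comm {x y z : P} (h : S.Col x y z) : S.Col y x z := by
  unfold Col at *; rwa [Set.insert_comm]

theorem Col.right_comm {x y z : P} (h : S.Col x y z) : S.Col x z y := by
  unfold Col at *; rwa [Set.pair_comm z y]

theorem Col.rotate {x y z : P} (h : S.Col x y z) : S.Col y z x := h.left_comm.right_comm

theorem Col.swap {x y z : P} (h : S.Col x y z) : S.Col z y x := h.rotate.left_comm

theorem Col.rotate' {x y z : P} (h : S.Col x y z) : S.Col z x y := h.rotate.rotate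

theorem exists_line {x y : P} (h : x ≠ y) : ∃ l ∈ S.lines, x ∈ l ∧ y ∈ l :=
  (S.exists_unique_line x y h).exists

theorem line_unique {x y : P} {l m : Set P} (h : x ≠ y) (hl : l ∈ S.lines) (hm : m ∈ S.lines)
    (hxl : x ∈ l) (hyl : y ∈ l) (hxm : x ∈ m) (hym : y ∈ m) : l = m :=
  (S.exists_unique_line x y h).unique ⟨hl, hxl, hyl⟩ ⟨hm, hxm, hym⟩

theorem eq_or_eq_of_mem {x y : P} {l m : Set P} (hxl : x ∈ l) (hxm : x ∈ m) (hyl : y ∈ l)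
    (hym : y ∈ m) (hl : l ∈ S.lines) (hm : m ∈ S.lines) : x = y ∨ l = m :=
  or_iff_not_imp_left.2 fun h => line_unique h hl hm hxl hyl hxm hym

theorem col_of_mem {x y z : P} {l : Set P} (hl : l ∈ S.lines) (hx : x ∈ l) (hy : y ∈ l)
    (hz : z ∈ l) : S.Col x y z :=
  Or.inr ⟨l, hl, by rintro _ (rfl | rfl | rfl) <;> assumption⟩

theorem Col.mem {x y z : P} {l : Set P} (h : S.Col x y z) (hxy : x ≠ y) (hl : l ∈ S.lines)
    (hx : x ∈ l) (hy : y ∈ l) : z ∈ l := by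
  rcases h with h | ⟨m, hm, h⟩
  · exact absurd (h (by simp) (by simp)) hxy
  · have := line_unique hxy hl hm hx hy (h (by simp)) (h (by simp))
    subst this
    exact h (by simp)

theorem col_self_left (x y : P) : S.Col x x y := by
  by_cases h : x = y
  · subst h; exact Or.inl (by simp)
  · obtain ⟨l, hl, hx, hy⟩ := exists_line (S := S) h
    exact col_of_mem hl hx hx hy

theorem Col.exists_common_line {x y z p q : P} (h : S.Col x y z) (hpq : p ≠ q) :
    ∃ l ∈ S.lines, x ∈ l ∧ y ∈ l ∧ z ∈ l := by
  rcases h with h | ⟨l, hl, h⟩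
  · have hy : y = x := h (by simp) (by simp)
    have hz : z = x := h (by simp) (by simp)
    subst hy hz
    obtain ⟨w, hw⟩ : ∃ w, z ≠ w := by
      by_contra! hcon
      exact hpq ((hcon p).symm.trans (hcon q))
    obtain ⟨l, hl, h1, -⟩ := exists_line (S := S) hw
    exact ⟨l, hl, h1, h1, h1⟩
  · exact ⟨l, hl, h (by simp), h (by simp), h (by simp)⟩

theorem col_self_right (x y : P) : S.Col x y y := (col_self_left y x).rotate'

theorem col_self_outer (x y : P) : S.Col x y x := (col_self_left x y).right_comm

/-- Two points of a line determine it. -/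
theorem Col.trans {x y z w : P} (hxy : x ≠ y) (h : S.Col x y z) (h' : S.Col x y w) :
    S.Col x z w := by
  obtain ⟨l, hl, hx, hy⟩ := exists_line (S := S) hxy
  exact col_of_mem hl hx (h.mem hxy hl hx hy) (h'.mem hxy hl hx hy)

theorem Col.trans₃ {x y z w u : P} (hxy : x ≠ y) (h : S.Col x y z) (h' : S.Col x y w)
    (h'' : S.Col x y u) : S.Col z w u := by
  obtain ⟨l, hl, hx, hy⟩ := exists_line (S := S) hxy
  exact col_of_mem hl (h.mem hxy hl hx hy) (h'.mem hxy hl hx hy) (h''.mem hxy hl hx hy)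

/-- The axiom of Veblen and Young, for points in any position. -/
theorem pasch {a b c d p : P} (h : S.Col a b p) (h' : S.Col c d p) :
    ∃ q, S.Col a c q ∧ S.Col b d q := by
  by_cases hab : a = b
  · subst hab; exact ⟨a, col_self_outer .., col_self_outer ..⟩
  by_cases hcd : c = d
  · subst hcd; exact ⟨c, col_self_right .., col_self_right ..⟩
  by_cases hac : a = c
  · subst hac; exact ⟨b, col_self_left .., col_self_outer ..⟩
  by_cases hbd : b = d
  · subst hbd; exact ⟨a, col_self_outer .., col_self_left ..⟩
  by_cases had : a = d
  · subst had; exact ⟨a, col_self_outer .., col_self_right ..⟩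
  by_cases hbc : b = c
  · subst hbc; exact ⟨b, col_self_right .., col_self_outer ..⟩
  obtain ⟨l, hl, h1, h2⟩ := exists_line (S := S) hab
  obtain ⟨m, hm, h3, h4⟩ := exists_line (S := S) hcd
  obtain ⟨n, hn, h5, h6⟩ := exists_line (S := S) hac
  obtain ⟨k, hk, h7, h8⟩ := exists_line (S := S) hbd
  obtain ⟨q, hq, hq'⟩ := S.veblen_young a b c d hab hac had hbc hbd hcd l hl m hm n hn k hk
    h1 h2 h3 h4 h5 h6 h7 h8 ⟨p, h.mem hab hl h1 h2, h'.mem hcd hm h3 h4⟩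
  exact ⟨q, col_of_mem hn h5 h6 hq, col_of_mem hk h7 h8 hq'⟩

theorem exists_third {x y : P} (h : x ≠ y) : ∃ z, S.Col x y z ∧ z ≠ x ∧ z ≠ y := by
  obtain ⟨l, hl, hx, hy⟩ := exists_line (S := S) h
  obtain ⟨a, ha, b, hb, c, hc, hab, hac, hbc⟩ := S.three_points l hl
  have key : ∃ z ∈ l, z ≠ x ∧ z ≠ y := by
    by_contra! hcon
    have h1 := hcon a ha
    have h2 := hcon b hb
    have h3 := hcon c hc
    by_cases hax : a = x
    · subst hax
      exact hbc ((h2 hab.symm).trans (h3 hac.symm).symm)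
    · by_cases hbx : b = x
      · subst hbx
        exact hac ((h1 hax).trans (h3 hbc.symm).symm)
      · exact hab ((h1 hax).trans (h2 hbx).symm)
  obtain ⟨z, hz, h1, h2⟩ := key
  exact ⟨z, col_of_mem hl hx hy hz, h1, h2⟩

/-! ### Subspaces and joins -/

theorem IsSubspace.mem {T : Set P} (hT : S.IsSubspace T) {x y z : P} (hx : x ∈ T) (hy : y ∈ T)
    (hxy : x ≠ y) (h : S.Col x y z) : z ∈ T := by
  obtain ⟨l, hl, hxl, hyl⟩ := exists_line (S := S) hxy
  exact hT x hx y hy hxy l hl hxl hyl (h.mem hxy hl hxl hyl)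

theorem isSubspace_of_col {T : Set P}
    (h : ∀ x ∈ T, ∀ y ∈ T, x ≠ y → ∀ z, S.Col x y z → z ∈ T) : S.IsSubspace T :=
  fun x hx y hy hxy _ hl hxl hyl z hz => h x hx y hy hxy z (col_of_mem hl hxl hyl hz)

theorem subset_span (M : Set P) : M ⊆ S.span M := Set.subset_sInter fun _ hT => hT.2

theorem isSubspace_span (M : Set P) : S.IsSubspace (S.span M) := by
  refine isSubspace_of_col fun x hx y hy hxy z hz => ?_
  rintro T ⟨hT, hMT⟩
  exact hT.mem (hx T ⟨hT, hMT⟩) (hy T ⟨hT, hMT⟩) hxy hz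

theorem span_subset {M T : Set P} (hT : S.IsSubspace T) (h : M ⊆ T) : S.span M ⊆ T :=
  Set.sInter_subset_of_mem ⟨hT, h⟩

theorem isSubspace_of_subsingleton {T : Set P} (h : T.Subsingleton) : S.IsSubspace T :=
  fun _ hx _ hy hxy => absurd (h hx hy) hxy

theorem join_self (x : P) : S.join {x} {x} = {x} := by
  rw [join, Set.union_self]
  exact (span_subset (isSubspace_of_subsingleton Set.subsingleton_singleton) le_rfl).antisymm
    (subset_span _)

theorem mem_join_iff_col {x y z : P} (h : x ≠ y) : z ∈ S.join {x} {y} ↔ S.Col x y z := by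
  constructor
  · intro hz
    refine span_subset (T := {z | S.Col x y z}) (isSubspace_of_col ?_) ?_ hz
    · intro a ha b hb hab c hc
      obtain ⟨l, hl, hx, hy⟩ := exists_line (S := S) h
      exact col_of_mem hl hx hy
        (hc.mem hab hl (Col.mem ha h hl hx hy) (Col.mem hb h hl hx hy))
    · rintro _ (rfl | rfl)
      exacts [col_self_outer .., col_self_right ..]
  · exact fun hz => (isSubspace_span _).mem (subset_span _ (by simp)) (subset_span _ (by simp)) h hz

/-! ### Hyperplanes -/

/-- A hyperplane: a proper subspace that meets every line. -/
structure IsHyperplane (S : ProjectiveSpace P) (H : Set P) : Prop where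
  isSubspace : S.IsSubspace H
  exists_notMem : ∃ o, o ∉ H
  exists_col : ∀ x y, x ≠ y → ∃ h ∈ H, S.Col x y h

/-- The lines joining a point to the points of a subspace cover a subspace. -/
theorem isSubspace_cone {H : Set P} (hH : S.IsSubspace H) {x : P} (hx : x ∉ H) :
    S.IsSubspace {z | ∃ h ∈ H, S.Col x h z} := by
  refine isSubspace_of_col ?_
  rintro z ⟨h, hh, hz⟩ w ⟨k, hk, hw⟩ hzw u hu
  by_cases hhk : h = k
  · subst hhk
    have hxh : x ≠ h := fun e => hx (e ▸ hh)
    obtain ⟨l, hl, h1, h2⟩ := exists_line (S := S) hxh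
    exact ⟨h, hh, col_of_mem hl h1 h2
      (hu.mem hzw hl (hz.mem hxh hl h1 h2) (hw.mem hxh hl h1 h2))⟩
  · obtain ⟨m, hm, hm'⟩ := pasch (S := S) hz.swap hw.swap
    have hmH : m ∈ H := hH.mem hh hk hhk hm'
    by_cases hhm : h = m
    · have hkm : k ≠ m := fun e => hhk (hhm.trans e.symm)
      obtain ⟨q, hq, hq'⟩ := pasch (S := S) hw (hu.trans₃ hzw hm (col_self_right z w))
      exact ⟨q, hH.mem hk hmH hkm hq', hq.right_comm⟩
    · obtain ⟨q, hq, hq'⟩ := pasch (S := S) hz (hu.trans₃ hzw hm (col_self_outer z w))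
      exact ⟨q, hH.mem hh hmH hhm hq', hq.right_comm⟩

theorem isSubspace_sUnion_of_isChain {c : Set (Set P)} (hc : IsChain (· ⊆ ·) c)
    (h : ∀ T ∈ c, S.IsSubspace T) : S.IsSubspace (⋃₀ c) := by
  refine isSubspace_of_col ?_
  rintro x ⟨T, hT, hx⟩ y ⟨U, hU, hy⟩ hxy z hz
  rcases hc.total hT hU with hTU | hTU
  · exact ⟨U, hU, (h U hU).mem (hTU hx) hy hxy hz⟩
  · exact ⟨T, hT, (h T hT).mem hx (hTU hy) hxy hz⟩

variable (S) in
/-- A maximal subspace that misses a given point is a hyperplane. -/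
theorem exists_isHyperplane (o : P) : ∃ H, S.IsHyperplane H ∧ o ∉ H := by
  obtain ⟨H, -, hH⟩ := zorn_subset_nonempty {T | S.IsSubspace T ∧ o ∉ T}
    (fun c hc hchain _ => ⟨⋃₀ c, ⟨isSubspace_sUnion_of_isChain hchain fun T hT => (hc hT).1,
      fun ⟨T, hT, ho⟩ => (hc hT).2 ho⟩, fun T hT => Set.subset_sUnion_of_mem hT⟩)
    ∅ ⟨isSubspace_of_subsingleton Set.subsingleton_empty, id⟩
  obtain ⟨⟨hHs, hHo⟩, hmax⟩ := hH
  -- By maximality, each point outside `H` is on a line joining `o` to a point of `H`.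
  have key : ∀ x, x ≠ o → ∃ h ∈ H, S.Col o h x := by
    intro x hxo
    by_cases hx : x ∈ H
    · exact ⟨x, hx, col_self_right ..⟩
    by_cases hne : H.Nonempty
    · obtain ⟨h₀, hh₀⟩ := hne
      by_contra hcon
      have hsub : H ⊆ {z | ∃ h ∈ H, S.Col x h z} := fun z hz => ⟨z, hz, col_self_right ..⟩
      have := hmax (y := {z | ∃ h ∈ H, S.Col x h z}) ⟨isSubspace_cone hHs hx,
        fun ⟨h, hh, hc⟩ => hcon ⟨h, hh, hc.swap⟩⟩ hsub
      exact hx (this ⟨h₀, hh₀, col_self_outer ..⟩)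
    · refine absurd (hmax (y := {x}) ⟨isSubspace_of_subsingleton Set.subsingleton_singleton,
        fun e => hxo (Eq.symm e)⟩ (fun z hz => absurd ⟨z, hz⟩ hne) rfl) hx
  refine ⟨H, ⟨hHs, ⟨o, hHo⟩, fun x y hxy => ?_⟩, hHo⟩
  by_cases hxo : x = o
  · subst hxo
    obtain ⟨h, hh, hc⟩ := key y hxy.symm
    exact ⟨h, hh, hc.right_comm⟩
  by_cases hyo : y = o
  · subst hyo
    obtain ⟨h, hh, hc⟩ := key x hxy
    exact ⟨h, hh, hc.rotate'⟩
  obtain ⟨h, hh, hc⟩ := key x hxo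
  obtain ⟨k, hk, hc'⟩ := key y hyo
  by_cases hhk : h = k
  · subst hhk
    have hoh : o ≠ h := fun e => hHo (e ▸ hh)
    exact ⟨h, hh, hc.trans₃ hoh hc' (col_self_right ..)⟩
  · obtain ⟨q, hq, hq'⟩ := pasch (S := S) hc.rotate hc'.rotate
    exact ⟨q, hHs.mem hh hk hhk hq, hq'⟩

namespace IsHyperplane

variable {H : Set P} (hH : S.IsHyperplane H)
include hH

/-- A line not contained in a hyperplane has one point in common with it. -/
theorem eq_of_col {x y d e : P} (hx : x ∉ H) (hd : d ∈ H) (he : e ∈ H) (hxy : x ≠ y)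
    (hcd : S.Col x y d) (hce : S.Col x y e) : d = e := by
  by_contra hde
  exact hx (hH.isSubspace.mem hd he hde (hcd.trans₃ hxy hce (col_self_outer x y)))

/-- In a space with a triangle, each line through a point outside a hyperplane misses another point
outside the hyperplane. -/
theorem exists_notMem_not_col (htri : ∃ x y z : P, ¬ S.Col x y z) {a c : P} (ha : a ∉ H)
    (hac : a ≠ c) : ∃ q, q ∉ H ∧ ¬ S.Col c a q := by
  have : ∃ p, ¬ S.Col c a p := by
    by_contra! hcon
    obtain ⟨x, y, z, h⟩ := htri
    exact h ((hcon x).trans₃ hac.symm (hcon y) (hcon z))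
  obtain ⟨p, hp⟩ := this
  by_cases hpH : p ∈ H
  · have hap : a ≠ p := fun e => ha (e ▸ hpH)
    obtain ⟨q, hq, hqa, hqp⟩ := exists_third (S := S) hap
    refine ⟨q, fun hqH => ha (hH.isSubspace.mem hpH hqH hqp.symm hq.rotate), fun hc => hp ?_⟩
    exact (hc.rotate.trans hqa.symm hq.right_comm).left_comm
  · exact ⟨p, hpH, hp⟩

end IsHyperplane

variable {H : Set P}

/-! ### Perspectivities -/

/-- `S.Persp H c a b x y` says that the dilation with axis `H` and centre `c` that takes `a` to `b`
has to take `x` to `y`, where `x` is not on the line `ca`: the point `y` is on the line `cx`, and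
the lines `ax` and `by` have a common point on `H`. -/
structure Persp (S : ProjectiveSpace P) (H : Set P) (c a b x y : P) : Prop where
  ha : a ∉ H
  hb : b ∉ H
  hx : x ∉ H
  hy : y ∉ H
  hbc : b ≠ c
  hyc : y ≠ c
  not_col : ¬ S.Col c a x
  col_left : S.Col c a b
  col_right : S.Col c x y
  exists_col : ∃ d ∈ H, S.Col a x d ∧ S.Col b y d

theorem not_col_ne {c a x : P} (h : ¬ S.Col c a x) : c ≠ a ∧ c ≠ x ∧ a ≠ x := by
  refine ⟨?_, ?_, ?_⟩ <;> rintro rfl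
  exacts [h (col_self_left ..), h (col_self_outer ..), h (col_self_right ..)]

namespace Persp

variable {c a b x y z w : P}

theorem symm (h : S.Persp H c a b x y) : S.Persp H c x y a b := by
  obtain ⟨d, hd, h1, h2⟩ := h.exists_col
  exact ⟨h.hx, h.hy, h.ha, h.hb, h.hyc, h.hbc, fun e => h.not_col e.right_comm, h.col_right,
    h.col_left, d, hd, h1.left_comm, h2.left_comm⟩

/-- The inverse dilation takes `b` to `a`. -/
theorem inv (h : S.Persp H c a b x y) : S.Persp H c b a y x := by
  obtain ⟨d, hd, h1, h2⟩ := h.exists_col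
  obtain ⟨h3, h4, h5⟩ := not_col_ne h.not_col
  refine ⟨h.hb, h.ha, h.hy, h.hx, h3.symm, h4.symm, fun e => h.not_col ?_, h.col_left.right_comm,
    h.col_right.right_comm, d, hd, h2, h1⟩
  have := h.col_left
  have := h.col_right
  have := h.hbc
  have := h.hyc
  grind only [→ Col.left_comm, → Col.right_comm, → Col.trans]

variable (hH : S.IsHyperplane H)
include hH

theorem exists_of_not_col (hb : b ∉ H) (ha : a ∉ H) (hx : x ∉ H) (hbc : b ≠ c)
    (hab : S.Col c a b) (hax : ¬ S.Col c a x) : ∃ y, S.Persp H c a b x y := by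
  obtain ⟨h3, h4, h5⟩ := not_col_ne hax
  obtain ⟨d, hd, had⟩ := hH.exists_col a x h5
  have hbd : b ≠ d := fun e => hb (e ▸ hd)
  have had' : a ≠ d := fun e => ha (e ▸ hd)
  have hxd : x ≠ d := fun e => hx (e ▸ hd)
  obtain ⟨y, hy, hy'⟩ := pasch (S := S) hab.right_comm had.rotate
  refine ⟨y, ha, hb, hx, fun hyH => ?_, hbc, ?_, hax, hab, hy, d, hd, had, hy'.right_comm⟩
  · have : y = d := by
      by_contra hyd
      exact hb (hH.isSubspace.mem hyH hd hyd hy'.swap)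
    grind only [→ Col.left_comm, → Col.right_comm, → Col.trans]
  · rintro rfl
    grind only [→ Col.left_comm, → Col.right_comm, → Col.trans]

theorem unique (h : S.Persp H c a b x y) (h' : S.Persp H c a b x z) : y = z := by
  obtain ⟨h3, h4, h5⟩ := not_col_ne h.not_col
  obtain ⟨d, hd, h1, h2⟩ := h.exists_col
  obtain ⟨d', hd', h1', h2'⟩ := h'.exists_col
  obtain rfl := hH.eq_of_col h.ha hd hd' h5 h1 h1'
  have hbd : b ≠ d := fun e => h.hb (e ▸ hd)
  obtain ⟨l, hl, hl1, hl2, hl3⟩ := h.col_left.exists_common_line h3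
  obtain ⟨m, hm, hm1, hm2, hm3⟩ := h.col_right.exists_common_line h3
  obtain ⟨m', hm', hm'1, hm'2, hm'3⟩ := h'.col_right.exists_common_line h3
  obtain ⟨k, hk, hk1, hk2, hk3⟩ := h2.exists_common_line h3
  obtain ⟨k', hk', hk'1, hk'2, hk'3⟩ := h2'.exists_common_line h3
  have := h.hbc
  have := h.not_col
  grind only [→ eq_or_eq_of_mem, col_of_mem]

theorem refl (ha : a ∉ H) (hx : x ∉ H) (h : ¬ S.Col c a x) :
    S.Persp H c a a x x := by
  obtain ⟨h3, h4, h5⟩ := not_col_ne h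
  obtain ⟨d, hd, had⟩ := hH.exists_col a x h5
  exact ⟨ha, ha, hx, hx, h3.symm, h4.symm, h, col_self_right .., col_self_right .., d, hd, had, had⟩

theorem eq_iff (h : S.Persp H c a b x y) : a = b ↔ x = y := by
  constructor
  · rintro rfl
    exact (refl hH h.ha h.hx h.not_col).unique hH h
  · rintro rfl
    exact (refl hH h.hx h.ha h.symm.not_col).unique hH h.symm

/-- By Desargues' theorem, a perspectivity may be transferred to another base line. -/
theorem trans (hS : S.IsDesarguesian) (h : S.Persp H c a b x y) (h' : S.Persp H c a b z w)
    (hxz : ¬ S.Col c x z) : S.Persp H c x y z w := by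
  obtain ⟨n1, n2, n3⟩ := not_col_ne h.not_col
  obtain ⟨n4, n5, n6⟩ := not_col_ne hxz
  obtain ⟨n7, n8, n9⟩ := not_col_ne h'.not_col
  refine ⟨h.hx, h.hy, h'.hx, h'.hy, h.hyc, h'.hyc, hxz, h.col_right, h'.col_right, ?_⟩
  by_cases hab : a = b
  · obtain rfl := (h.eq_iff hH).1 hab
    obtain rfl := (h'.eq_iff hH).1 hab
    obtain ⟨d, hd, hd'⟩ := hH.exists_col x z n6
    exact ⟨d, hd, hd', hd'⟩
  obtain ⟨d, hd, hd1, hd2⟩ := h.exists_col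
  obtain ⟨e, he, he1, he2⟩ := h'.exists_col
  have had : a ≠ d := fun e => h.ha (e ▸ hd)
  have hbd : b ≠ d := fun e => h.hb (e ▸ hd)
  by_cases haxz : S.Col a x z
  · have hed : e = d := hH.eq_of_col h.ha he hd n3 (haxz.right_comm.trans n9 he1) hd1
    subst hed
    exact ⟨e, he, (col_self_right a x).trans₃ n3 haxz hd1,
      hd2.right_comm.trans₃ hbd he2.right_comm (col_self_right b e)⟩
  have hde : d ≠ e := by
    rintro rfl
    exact haxz ((col_self_outer a d).trans₃ had hd1.right_comm he1.right_comm)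
  obtain ⟨q, hq1, hq2⟩ := pasch (S := S) h.col_right.rotate h'.col_right.rotate
  have hbyw : ¬ S.Col b y w := fun hc => hde <| by
    refine hH.eq_of_col h.hb hd he ?_ hd2 ?_
    · exact (not_col_ne h.inv.not_col).2.2
    · exact hc.right_comm.trans (not_col_ne h'.inv.not_col).2.2 he2
  have hyw : ¬ S.Col c y w := fun hc => hxz <|
    (h.col_right.right_comm.trans h.hyc.symm hc).right_comm.trans h'.hyc.symm
      h'.col_right.right_comm
  have := hS c a x z b y w d e q h.col_left h.col_right h'.col_right hab
    (fun e => hab ((h.eq_iff hH).2 e)) (fun e => hab ((h'.eq_iff hH).2 e))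
    h.not_col h'.not_col hxz haxz h.inv.not_col h'.inv.not_col hyw hbyw
    hd1 hd2 he1 he2 hq1 hq2
  exact ⟨q, hH.isSubspace.mem hd he hde this, hq1, hq2⟩

/-- If a line through the centre has three points outside the hyperplane, then there is a point
outside the hyperplane that is off two given lines through the centre. -/
theorem exists_off {q t : P} (ha : a ∉ H) (hqH : q ∉ H) (ht : t ∉ H) (hbc : b ≠ c)
    (hab : S.Col c a b) (hat : S.Col c a t) (hq : ¬ S.Col c a q) (nab : a ≠ b)
    (nat : t ≠ a) (nbt : t ≠ b) :
    ∃ r, r ∉ H ∧ ¬ S.Col c a r ∧ ¬ S.Col c q r := by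
  obtain ⟨n1, n2, n3⟩ := not_col_ne hq
  obtain ⟨s, hs, hs'⟩ := hH.exists_col a q n3
  have has : a ≠ s := fun e => ha (e ▸ hs)
  have hts : t ≠ s := fun e => ht (e ▸ hs)
  obtain ⟨r, hr, hr'⟩ := pasch (S := S) (a := t) (b := b) (c := s) (d := q) (p := a)
    ((hat.trans₃ n1 hab (col_self_right c a))) hs'.swap
  obtain ⟨l, hl, l1, l2, l3⟩ := hab.exists_common_line n1
  have l4 := hat.mem n1 hl l1 l2
  obtain ⟨m, hm, m1, m2, m3⟩ := hs'.exists_common_line n1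
  obtain ⟨k, hk, k1, k2, k3⟩ := hr.exists_common_line n1
  obtain ⟨j, hj, j1, j2, j3⟩ := hr'.exists_common_line n1
  refine ⟨r, fun hrH => ?_, fun hc => ?_, fun hc => ?_⟩
  · have : r = s := by
      by_contra hrs
      exact ht (hH.isSubspace.mem hrH hs hrs hr.swap)
    grind only [→ eq_or_eq_of_mem, col_of_mem]
  · have := hc.mem n1 hl l1 l2
    grind only [→ eq_or_eq_of_mem, col_of_mem]
  · obtain ⟨i, hi, i1, i2, i3⟩ := hc.exists_common_line n1
    grind only [→ eq_or_eq_of_mem, col_of_mem]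

variable {q q' : P}

/-- Transfer of a perspectivity to a base line where it had to be defined by means of the auxiliary
pair `(q, q')`. -/
theorem trans_base (hS : S.IsDesarguesian) (h : S.Persp H c a b q q') (hz : S.Persp H c a b z w)
    (hqz : S.Col c q z) (hx : S.Persp H c q q' x y) (hax : S.Col c a x) :
    S.Persp H c x y z w := by
  obtain ⟨n1, n2, n3⟩ := not_col_ne h.not_col
  obtain ⟨n4, n5, n6⟩ := not_col_ne hz.not_col
  obtain ⟨n7, n8, n9⟩ := not_col_ne hx.not_col
  have hxz : ¬ S.Col c x z := fun e =>
    hx.not_col (hqz.right_comm.trans n5 e.right_comm)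
  by_cases hzq : z = q
  · subst hzq
    obtain rfl := hz.unique hH h
    exact hx.symm
  by_cases hxa : x = a
  · subst hxa
    obtain rfl := hx.unique hH h.symm
    exact hz
  -- A third line through the centre connects the two base lines.
  by_cases hr : ∃ r, r ∉ H ∧ ¬ S.Col c a r ∧ ¬ S.Col c q r
  · obtain ⟨r, hrH, har, hqr⟩ := hr
    obtain ⟨r', hr⟩ := exists_of_not_col hH h.hb h.ha hrH h.hbc h.col_left har
    have h1 := h.trans hH hS hr hqr
    have h2 := h1.trans hH hS hx fun e => har (hax.right_comm.trans n8 e.right_comm)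
    have h3 := hr.trans hH hS hz fun e => hqr (hqz.right_comm.trans n5 e.right_comm)
    exact h2.trans hH hS h3 hxz
  by_cases hab : a = b
  · obtain rfl := (h.eq_iff hH).1 hab
    obtain rfl := (hz.eq_iff hH).1 hab
    obtain rfl := (hx.eq_iff hH).1 rfl
    exact refl hH hx.hx hz.hx hxz
  -- Otherwise each of the two base lines has just two points outside the hyperplane.
  have key : ∀ t, t ∉ H → S.Col c a t → t ≠ a → t = b := fun t ht hat hta => by
    by_contra htb
    exact hr (exists_off hH h.ha h.hx ht h.hbc h.col_left hat h.not_col hab hta htb)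
  have key' : ∀ t, t ∉ H → S.Col c q t → t ≠ q → t = q' := fun t ht hat hta => by
    by_contra htb
    obtain ⟨r, h1, h2, h3⟩ := exists_off hH h.hx h.ha ht h.hyc h.col_right hat
      (fun e => h.not_col e.right_comm) (fun e => hab ((h.eq_iff hH).2 e)) hta htb
    exact hr ⟨r, h1, h3, h2⟩
  obtain rfl := key x hx.hx hax hxa
  obtain rfl := key' z hz.hx hqz hzq
  have hya : y = a := by
    by_contra hya
    obtain rfl := key y hx.hy (hax.right_comm.trans n8 hx.col_right) hya
    exact hzq ((hx.eq_iff hH).2 rfl).symm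
  have hwq : w = q := by
    by_contra hwq
    obtain rfl := key' w hz.hy (hqz.right_comm.trans n5 hz.col_right) hwq
    exact hab ((hz.eq_iff hH).2 rfl)
  rw [hya, hwq]
  exact h.inv

end Persp

variable {c a b q q' x y z w : P}

/-! ### Dilations of the complement of a hyperplane -/

/-- The graph of the dilation with centre `c` that takes `a` to `b`. The pair `(q, q')` defines it
on the line `ca`. -/
def DilationRel (S : ProjectiveSpace P) (H : Set P) (c a b q q' x y : P) : Prop :=
  (x = c ∧ y = c) ∨ S.Persp H c a b x y ∨ (S.Col c a x ∧ S.Persp H c q q' x y)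

namespace DilationRel

theorem inv (h : S.Persp H c a b q q') (hxy : DilationRel S H c a b q q' x y) :
    DilationRel S H c b a q' q y x := by
  rcases hxy with ⟨rfl, rfl⟩ | hxy | ⟨hax, hxy⟩
  · exact Or.inl ⟨rfl, rfl⟩
  · exact Or.inr (Or.inl hxy.inv)
  · refine Or.inr (Or.inr ⟨?_, hxy.inv⟩)
    have hcx := (not_col_ne hxy.not_col).2.1
    have hca := (not_col_ne h.not_col).1
    exact (col_self_outer c a).trans₃ hca h.col_left
      ((hax.right_comm.trans hcx hxy.col_right))

theorem col (hxy : DilationRel S H c a b q q' x y) : S.Col c x y := by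
  rcases hxy with ⟨rfl, rfl⟩ | hxy | ⟨hax, hxy⟩
  exacts [col_self_left .., hxy.col_right, hxy.col_right]

theorem eq_center (hxy : DilationRel S H c a b q q' c y) : y = c := by
  rcases hxy with ⟨-, hy⟩ | hxy | ⟨hax, hxy⟩
  exacts [hy, absurd rfl (not_col_ne hxy.not_col).2.1, absurd rfl (not_col_ne hxy.not_col).2.1]

variable (hH : S.IsHyperplane H)
include hH

theorem exists_of_notMem (h : S.Persp H c a b q q') (hx : x ∉ H) :
    ∃ y, y ∉ H ∧ DilationRel S H c a b q q' x y := by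
  by_cases hxc : x = c
  · exact ⟨c, hxc ▸ hx, Or.inl ⟨hxc, rfl⟩⟩
  by_cases hax : S.Col c a x
  · obtain ⟨y, hy⟩ := Persp.exists_of_not_col hH h.hy h.hx hx h.hyc h.col_right
      fun e => h.not_col (hax.right_comm.trans (Ne.symm hxc) e.right_comm)
    exact ⟨y, hy.hy, Or.inr (Or.inr ⟨hax, hy⟩)⟩
  · obtain ⟨y, hy⟩ := Persp.exists_of_not_col hH h.hb h.ha hx h.hbc h.col_left hax
    exact ⟨y, hy.hy, Or.inr (Or.inl hy)⟩

theorem unique (h : DilationRel S H c a b q q' x y) (h' : DilationRel S H c a b q q' x z) :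
    y = z := by
  rcases h with ⟨rfl, rfl⟩ | h | ⟨hax, h⟩
  · exact h'.eq_center.symm
  all_goals
    have hc := (not_col_ne h.not_col).2.1
    rcases h' with ⟨rfl, rfl⟩ | h' | ⟨hax', h'⟩
    · exact absurd rfl hc
  exacts [h.unique hH h', absurd hax' h.not_col, absurd hax h'.not_col, h.unique hH h']

/-- The dilation preserves the points at infinity of lines. -/
theorem col_of_col (hS : S.IsDesarguesian) (h : S.Persp H c a b q q')
    (hxy : DilationRel S H c a b q q' x y) (hzw : DilationRel S H c a b q q' z w) (hx : x ∉ H)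
    (hz : z ∉ H) {d : P} (hd : d ∈ H) (hxz : S.Col x z d) : S.Col y w d := by
  by_cases hne : x = z
  · subst hne
    obtain rfl := hxy.unique hH hzw
    exact col_self_left ..
  have hx' := hxy.col
  have hz' := hzw.col
  by_cases hxc : x = c
  · subst hxc
    obtain rfl := hxy.eq_center
    exact hz'.trans hne hxz
  by_cases hzc : z = c
  · subst hzc
    obtain rfl := hzw.eq_center
    exact (hx'.trans (Ne.symm hne) hxz.left_comm).left_comm
  by_cases hcol : S.Col c x z
  · exact hx'.trans₃ (Ne.symm hxc) (hcol.right_comm.trans (Ne.symm hzc) hz')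
      (hcol.rotate.trans₃ hne (col_self_outer ..) hxz)
  have key : S.Persp H c x y z w := by
    rcases hxy with ⟨rfl, rfl⟩ | hxy | ⟨hax, hxy⟩
    · exact absurd rfl hxc
    all_goals
      rcases hzw with ⟨rfl, rfl⟩ | hzw | ⟨haz, hzw⟩
      · exact absurd rfl hzc
    · exact hxy.trans hH hS hzw hcol
    · by_cases hqx : S.Col c q x
      · exact (h.trans_base hH hS hxy hqx hzw haz).symm
      · exact (h.trans hH hS hxy hqx).trans hH hS hzw hcol
    · by_cases hqz : S.Col c q z
      · exact h.trans_base hH hS hzw hqz hxy hax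
      · exact hxy.trans hH hS (h.trans hH hS hzw hqz) hcol
    · exact absurd (hax.trans (not_col_ne h.not_col).1 haz) hcol
  obtain ⟨e, he, he1, he2⟩ := key.exists_col
  rwa [hH.eq_of_col hx hd he hne hxz he1]

end DilationRel

/-- A dilation of the complement of `H`: a permutation that preserves the points at infinity of
lines. -/
def IsDilation (S : ProjectiveSpace P) (H : Set P) (σ : Equiv.Perm {x // x ∉ H}) : Prop :=
  ∀ d ∈ H, ∀ x y, S.Col x.1 y.1 d → S.Col (σ x).1 (σ y).1 d

/-- In a desarguesian projective space, each dilation that the incidence axioms permit exists. -/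
theorem exists_isDilation (hS : S.IsDesarguesian) (htri : ∃ x y z : P, ¬ S.Col x y z)
    (hH : S.IsHyperplane H) {c : P} {a b : {x // x ∉ H}} (hac : a.1 ≠ c) (hbc : b.1 ≠ c)
    (hab : S.Col c a b) : ∃ σ : Equiv.Perm {x // x ∉ H}, S.IsDilation H σ ∧ σ a = b ∧
      (∀ x, S.Col c x.1 (σ x).1) ∧ ∀ x, x.1 = c → σ x = x := by
  obtain ⟨q, hq, hcq⟩ := hH.exists_notMem_not_col htri a.2 hac
  obtain ⟨q', h⟩ := Persp.exists_of_not_col hH b.2 a.2 hq hbc hab hcq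
  choose f hf using fun x : {x // x ∉ H} => DilationRel.exists_of_notMem hH h x.2
  choose g hg using fun x : {x // x ∉ H} => DilationRel.exists_of_notMem hH h.inv x.2
  let σ : Equiv.Perm {x // x ∉ H} :=
    { toFun := fun x => ⟨f x, (hf x).1⟩
      invFun := fun x => ⟨g x, (hg x).1⟩
      left_inv := fun x => Subtype.ext
        ((hg ⟨f x, (hf x).1⟩).2.unique hH ((hf x).2.inv h))
      right_inv := fun x => Subtype.ext
        ((hf ⟨g x, (hg x).1⟩).2.unique hH ((hg x).2.inv h.inv)) }
  refine ⟨σ, fun d hd x y hxy => (hf x).2.col_of_col hH hS h (hf y).2 x.2 y.2 hd hxy, ?_,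
    fun x => (hf x).2.col, ?_⟩
  · exact Subtype.ext ((hf a).2.unique hH (Or.inr (Or.inr ⟨col_self_right .., h.symm⟩)))
  · exact fun x hx => Subtype.ext ((hf x).2.unique hH (Or.inl ⟨hx, hx⟩))

end ProjectiveSpace

/-! ### Translation groups of desarguesian affine spaces -/

/-- A desarguesian affine space of dimension at least two, given by its points, by its directions
(the parallel classes of lines) and by the relation `par d x y`: the points `x` and `y` are equal or
their line has direction `d`. Desargues' theorem is replaced by its consequences, the existence of
translations and homotheties. -/
structure DesarguesianAffineSpace (A D : Type*) where
  par : D → A → A → Prop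
  nonempty_direction : Nonempty D
  equivalence : ∀ d, Equivalence (par d)
  exists_par_of_ne : ∀ x y, x ≠ y → ∃ d, par d x y
  eq_of_par : ∀ x y c d, par c x y → par d x y → c ≠ d → x = y
  exists_not_par : ∀ d x, ∃ y, ¬ par d x y
  exists_ne_par : ∀ d x, ∃ y, y ≠ x ∧ par d x y
  exists_translation : ∀ d x y, par d x y → ∃ σ : Equiv.Perm A,
    (∀ e z w, par e z w → par e (σ z) (σ w)) ∧ (∀ z, par d z (σ z)) ∧ σ x = y
  exists_homothety : ∀ d o x y, par d o x → par d o y → x ≠ o → y ≠ o → ∃ σ : Equiv.Perm A,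
    (∀ e z w, par e z w → par e (σ z) (σ w)) ∧ σ o = o ∧ σ x = y

namespace DesarguesianAffineSpace

theorem perm_apply_inv {A : Type*} (σ : Equiv.Perm A) (x : A) : σ (σ⁻¹ x) = x :=
  σ.apply_symm_apply x

theorem perm_inv_apply {A : Type*} (σ : Equiv.Perm A) (x : A) : σ⁻¹ (σ x) = x :=
  σ.symm_apply_apply x

variable {A D : Type*} (𝔸 : DesarguesianAffineSpace A D)

/-- The group of dilations. -/
def dilation : Subgroup (Equiv.Perm A) where
  carrier := {σ | ∀ d x y, 𝔸.par d x y → 𝔸.par d (σ x) (σ y)}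
  one_mem' := fun _ _ _ h => h
  mul_mem' := fun hσ hτ d x y h => hσ d _ _ (hτ d x y h)
  inv_mem' := by
    intro σ hσ d x y h
    by_cases hxy : x = y
    · subst hxy; exact (𝔸.equivalence d).refl _
    obtain ⟨e, he⟩ := 𝔸.exists_par_of_ne (σ⁻¹ x) (σ⁻¹ y) fun e => hxy (σ⁻¹.injective e)
    have := hσ e _ _ he
    rw [perm_apply_inv, perm_apply_inv] at this
    by_cases hed : e = d
    · exact hed ▸ he
    · exact absurd (𝔸.eq_of_par _ _ _ _ this h hed) hxy

/-- The group of translations in a given direction. -/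
def translationIn (d : D) : Subgroup (Equiv.Perm A) where
  carrier := {σ | σ ∈ 𝔸.dilation ∧ ∀ x, 𝔸.par d x (σ x)}
  one_mem' := ⟨one_mem _, fun x => (𝔸.equivalence d).refl x⟩
  mul_mem' := fun hσ hτ => ⟨mul_mem hσ.1 hτ.1,
    fun x => (𝔸.equivalence d).trans (hτ.2 x) (hσ.2 _)⟩
  inv_mem' := fun {σ} hσ => ⟨inv_mem hσ.1, fun x => by
    simpa using (𝔸.equivalence d).symm (hσ.2 (σ⁻¹ x))⟩

variable {𝔸}

theorem apply_eq_of_not_par {σ : Equiv.Perm A} (hσ : σ ∈ 𝔸.dilation) {x y z : A} {d : D}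
    (hx : σ x = x) (hy : σ y = y) (hne : x ≠ y) (hxy : 𝔸.par d x y) (hz : ¬ 𝔸.par d x z) :
    σ z = z := by
  obtain ⟨e, he⟩ := 𝔸.exists_par_of_ne x z
    fun h => hz (h ▸ (𝔸.equivalence d).refl x)
  obtain ⟨f, hf⟩ := 𝔸.exists_par_of_ne y z fun h => hz (h ▸ hxy)
  have he' := hσ e _ _ he
  have hf' := hσ f _ _ hf
  rw [hx] at he'
  rw [hy] at hf'
  refine 𝔸.eq_of_par _ _ e f ((𝔸.equivalence e).trans ((𝔸.equivalence e).symm he') he)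
    ((𝔸.equivalence f).trans ((𝔸.equivalence f).symm hf') hf) ?_
  rintro rfl
  by_cases hed : e = d
  · exact hz (hed ▸ he)
  · exact hne (𝔸.eq_of_par _ _ _ _ ((𝔸.equivalence e).trans he ((𝔸.equivalence e).symm hf)) hxy
      hed)

/-- A dilation with two fixed points is the identity. -/
theorem eq_one_of_two_fixed {σ : Equiv.Perm A} (hσ : σ ∈ 𝔸.dilation) {x y : A}
    (hx : σ x = x) (hy : σ y = y) (hne : x ≠ y) : σ = 1 := by
  obtain ⟨d, hd⟩ := 𝔸.exists_par_of_ne x y hne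
  ext z
  rw [Equiv.Perm.one_apply]
  by_cases hz : 𝔸.par d x z
  · obtain ⟨w, hw⟩ := 𝔸.exists_not_par d x
    have hw' := apply_eq_of_not_par hσ hx hy hne hd hw
    by_cases hxz : x = z
    · rw [← hxz, hx]
    have hxw : x ≠ w := fun h => hw (h ▸ (𝔸.equivalence d).refl x)
    obtain ⟨e, he⟩ := 𝔸.exists_par_of_ne x w hxw
    refine apply_eq_of_not_par hσ hx hw' hxw he fun hez => hxz ?_
    exact 𝔸.eq_of_par _ _ _ _ hez hz fun hed => hw (hed ▸ he)
  · exact apply_eq_of_not_par hσ hx hy hne hd hz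

theorem eq_one_of_fixed {σ : Equiv.Perm A} {d : D} (hσ : σ ∈ 𝔸.translationIn d) {x : A}
    (hx : σ x = x) : σ = 1 := by
  obtain ⟨y, hy⟩ := 𝔸.exists_not_par d x
  have hxy : x ≠ y := fun h => hy (h ▸ (𝔸.equivalence d).refl x)
  obtain ⟨e, he⟩ := 𝔸.exists_par_of_ne x y hxy
  refine eq_one_of_two_fixed hσ.1 hx ?_ hxy
  have he' := hσ.1 e _ _ he
  rw [hx] at he'
  exact 𝔸.eq_of_par _ _ e d ((𝔸.equivalence e).trans ((𝔸.equivalence e).symm he') he)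
    ((𝔸.equivalence d).symm (hσ.2 y)) fun hed => hy (hed ▸ he)

theorem eq_one_of_mem_mem {σ : Equiv.Perm A} {c d : D} (hc : σ ∈ 𝔸.translationIn c)
    (hd : σ ∈ 𝔸.translationIn d) (hcd : c ≠ d) : σ = 1 := by
  ext x
  exact (𝔸.eq_of_par _ _ _ _ (hc.2 x) (hd.2 x) hcd).symm

theorem conj_mem_translationIn {σ δ : Equiv.Perm A} {d : D} (hδ : δ ∈ 𝔸.dilation)
    (hσ : σ ∈ 𝔸.translationIn d) : δ * σ * δ⁻¹ ∈ 𝔸.translationIn d := by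
  refine ⟨mul_mem (mul_mem hδ hσ.1) (inv_mem hδ), fun x => ?_⟩
  have := hδ d _ _ (hσ.2 (δ⁻¹ x))
  rwa [perm_apply_inv] at this

theorem commute_of_ne {σ τ : Equiv.Perm A} {c d : D} (hσ : σ ∈ 𝔸.translationIn c)
    (hτ : τ ∈ 𝔸.translationIn d) (hcd : c ≠ d) : Commute σ τ := by
  have h1 : σ * τ * σ⁻¹ * τ⁻¹ ∈ 𝔸.translationIn d :=
    mul_mem (conj_mem_translationIn hσ.1 hτ) (inv_mem hτ)
  have h2 : σ * τ * σ⁻¹ * τ⁻¹ ∈ 𝔸.translationIn c := by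
    have := mul_mem hσ (conj_mem_translationIn hτ.1 (inv_mem hσ))
    simpa only [mul_assoc] using this
  have := eq_one_of_mem_mem h2 h1 hcd
  rw [mul_inv_eq_one, mul_inv_eq_iff_eq_mul] at this
  exact this

theorem exists_mem_translationIn {x y : A} {d : D} (h : 𝔸.par d x y) :
    ∃ σ ∈ 𝔸.translationIn d, σ x = y := by
  obtain ⟨σ, h1, h2, h3⟩ := 𝔸.exists_translation d x y h
  exact ⟨σ, ⟨h1, h2⟩, h3⟩

theorem exists_mul_mem {σ τ : Equiv.Perm A} {c d : D} (hσ : σ ∈ 𝔸.translationIn c)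
    (hτ : τ ∈ 𝔸.translationIn d) (x : A) : ∃ e, σ * τ ∈ 𝔸.translationIn e := by
  by_cases hcd : c = d
  · subst hcd; exact ⟨c, mul_mem hσ hτ⟩
  by_cases hσ1 : σ x = x
  · rw [eq_one_of_fixed hσ hσ1, one_mul]; exact ⟨d, hτ⟩
  by_cases hτ1 : τ x = x
  · rw [eq_one_of_fixed hτ hτ1, mul_one]; exact ⟨c, hσ⟩
  have hcomm := commute_of_ne hσ hτ hcd
  have hστ : σ (τ x) = τ (σ x) := congrArg (· x) hcomm.eq
  have hx : x ≠ σ (τ x) := fun h => by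
    have h1 := 𝔸.eq_of_par x (τ x) c d ?_ (hτ.2 x) hcd
    · exact hτ1 h1.symm
    · have := (𝔸.equivalence c).symm (hσ.2 (τ x))
      rwa [← h] at this
  obtain ⟨e, he⟩ := 𝔸.exists_par_of_ne _ _ hx
  have hec : e ≠ c := fun h => by
    subst h
    refine hτ1 (𝔸.eq_of_par x (τ x) e d ?_ (hτ.2 x) hcd).symm
    exact (𝔸.equivalence e).trans he ((𝔸.equivalence e).symm (hσ.2 (τ x)))
  have hed : e ≠ d := fun h => by
    subst h
    refine hσ1 (𝔸.eq_of_par x (σ x) c e (hσ.2 x) ?_ hcd).symm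
    rw [hστ] at he
    exact (𝔸.equivalence e).trans he ((𝔸.equivalence e).symm (hτ.2 (σ x)))
  obtain ⟨ρ, hρ, hρx⟩ := exists_mem_translationIn he
  -- The dilation `ρ⁻¹ * (σ * τ)` fixes `x` and commutes with `σ`, so it also fixes `σ x`.
  have hκσ : Commute (ρ⁻¹ * (σ * τ)) σ :=
    ((commute_of_ne hρ hσ hec).inv_left).mul_left ((Commute.refl σ).mul_left hcomm.symm)
  have hκx : (ρ⁻¹ * (σ * τ)) x = x := by
    rw [Equiv.Perm.mul_apply, Equiv.Perm.mul_apply, ← hρx, perm_inv_apply]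
  have hκ : ρ⁻¹ * (σ * τ) = 1 := by
    refine eq_one_of_two_fixed (mul_mem (inv_mem hρ.1) (mul_mem hσ.1 hτ.1)) hκx ?_
      (Ne.symm hσ1)
    have := congrArg (· x) hκσ.eq
    simp only [Equiv.Perm.mul_apply] at this hκx ⊢
    rw [this, hκx]
  exact ⟨e, by rwa [← inv_mul_eq_one.1 hκ]⟩

theorem exists_ne_mem_translationIn (d : D) (x : A) :
    ∃ σ ∈ 𝔸.translationIn d, σ ≠ 1 := by
  obtain ⟨y, hy, hxy⟩ := 𝔸.exists_ne_par d x
  obtain ⟨σ, hσ, h⟩ := exists_mem_translationIn hxy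
  exact ⟨σ, hσ, fun h' => hy (by rw [← h, h', Equiv.Perm.one_apply])⟩

theorem commute {σ τ : Equiv.Perm A} {c d : D} (hσ : σ ∈ 𝔸.translationIn c)
    (hτ : τ ∈ 𝔸.translationIn d) (x : A) : Commute σ τ := by
  by_cases hcd : c = d
  · subst hcd
    obtain ⟨y, hy⟩ := 𝔸.exists_not_par c x
    obtain ⟨d, hd⟩ := 𝔸.exists_par_of_ne x y fun h => hy (h ▸ (𝔸.equivalence c).refl x)
    have hdc : c ≠ d := fun h => hy (h ▸ hd)
    obtain ⟨ρ, hρ, hρ1⟩ := exists_ne_mem_translationIn (𝔸 := 𝔸) d x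
    obtain ⟨e, he⟩ := exists_mul_mem hρ hτ x
    have hec : c ≠ e := fun h => by
      subst h
      exact hρ1 (eq_one_of_mem_mem ((mul_mem_cancel_right hτ).1 he) hρ hdc)
    have h1 := commute_of_ne hσ he hec
    have h2 := commute_of_ne hσ hρ hdc
    have := h2.inv_right.mul_right h1
    rwa [inv_mul_cancel_left] at this
  · exact commute_of_ne hσ hτ hcd

/-- The group of all translations. -/
def translation [Nonempty A] : Subgroup (Equiv.Perm A) where
  carrier := {σ | ∃ d, σ ∈ 𝔸.translationIn d}
  one_mem' := ⟨𝔸.nonempty_direction.some, one_mem _⟩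
  mul_mem' := fun ⟨_, hσ⟩ ⟨_, hτ⟩ => exists_mul_mem hσ hτ (Classical.arbitrary A)
  inv_mem' := fun ⟨d, hσ⟩ => ⟨d, inv_mem hσ⟩

instance [Nonempty A] : CommGroup 𝔸.translation :=
  { (inferInstance : Group 𝔸.translation) with
    mul_comm := fun ⟨_, _, hσ⟩ ⟨_, _, hτ⟩ =>
      Subtype.ext (commute hσ hτ (Classical.arbitrary A)).eq }

theorem bijective_apply [Nonempty A] (o : A) :
    Function.Bijective fun σ : 𝔸.translation => σ.1 o := by
  constructor
  · rintro ⟨σ, hσ⟩ ⟨τ, hτ⟩ (h : σ o = τ o)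
    obtain ⟨d, hd⟩ := mul_mem (inv_mem hτ) hσ
    have := eq_one_of_fixed hd (x := o)
      (by rw [Equiv.Perm.mul_apply, h, perm_inv_apply])
    exact Subtype.ext (inv_mul_eq_one.1 this).symm
  · intro x
    by_cases hx : o = x
    · exact ⟨1, hx⟩
    obtain ⟨d, hd⟩ := 𝔸.exists_par_of_ne o x hx
    obtain ⟨σ, hσ, h⟩ := exists_mem_translationIn hd
    exact ⟨⟨σ, d, hσ⟩, h⟩

/-- The translations form an abelian group that acts regularly on the points, so the points may be
identified with the elements of an abelian group. The directions become subgroups, and homotheties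
become endomorphisms. -/
theorem exists_addCommGroup {A : Type u} {D : Type*} (𝔸 : DesarguesianAffineSpace A D)
    [Nonempty A] :
    ∃ (V : Type u) (_ : AddCommGroup V) (t : A ≃ V) (dir : D → AddSubgroup V),
      (∀ d x y, 𝔸.par d x y ↔ t y - t x ∈ dir d) ∧
      ∀ d, ∀ v ∈ dir d, ∀ w ∈ dir d, v ≠ 0 → w ≠ 0 →
        ∃ α : AddMonoid.End V, (∀ e, ∀ u ∈ dir e, α u ∈ dir e) ∧ α v = w := by
  let o : A := Classical.arbitrary A
  let f : 𝔸.translation ≃ A := Equiv.ofBijective _ (bijective_apply o)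
  have hf : ∀ σ, f σ = σ.1 o := fun _ => rfl
  let dir : D → AddSubgroup (Additive 𝔸.translation) := fun d =>
    Subgroup.toAddSubgroup ((𝔸.translationIn d).subgroupOf 𝔸.translation)
  have hdir : ∀ d (v : Additive 𝔸.translation), v ∈ dir d ↔
    (v.toMul : Equiv.Perm A) ∈ 𝔸.translationIn d := fun d v => Iff.rfl
  refine ⟨Additive 𝔸.translation, inferInstance, f.symm.trans Additive.ofMul, dir, ?_, ?_⟩
  · intro d x y
    obtain ⟨σ, rfl⟩ := f.surjective x
    obtain ⟨τ, rfl⟩ := f.surjective y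
    rw [hdir]
    simp only [Equiv.trans_apply, Equiv.symm_apply_apply, ← ofMul_div, toMul_ofMul]
    have hτ : (((τ / σ : 𝔸.translation)) : Equiv.Perm A) (f σ) = f τ := by
      rw [hf, hf, ← Equiv.Perm.mul_apply, ← Subgroup.coe_mul, div_mul_cancel]
    constructor
    · intro h
      obtain ⟨ρ, hρ, hρ'⟩ := exists_mem_translationIn h
      have : (⟨ρ, d, hρ⟩ : 𝔸.translation) * σ = τ := by
        apply f.injective
        rw [← hρ', hf, hf]
        rfl
      rw [← this, mul_div_cancel_right]
      exact hρ
    · intro h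
      have := h.2 (f σ)
      rwa [hτ] at this
  · intro d v hv w hw hv0 hw0
    obtain ⟨σ, rfl⟩ := Additive.ofMul.surjective v
    obtain ⟨τ, rfl⟩ := Additive.ofMul.surjective w
    rw [hdir] at hv hw
    have h0 : ∀ σ : 𝔸.translation, Additive.ofMul σ ≠ 0 → f σ ≠ o := by
      intro σ hσ h
      refine hσ (congrArg Additive.ofMul (f.injective (a₂ := 1) ?_))
      rw [h]; rfl
    obtain ⟨δ, hδ, hδo, hδσ⟩ := 𝔸.exists_homothety d o (f σ) (f τ) (hv.2 o) (hw.2 o)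
      (h0 _ hv0) (h0 _ hw0)
    have hδ' : δ ∈ 𝔸.dilation := hδ
    let α : 𝔸.translation →* 𝔸.translation :=
      { toFun := fun ρ => ⟨δ * ρ.1 * δ⁻¹, by
          obtain ⟨ρ, e, he⟩ := ρ
          exact ⟨e, conj_mem_translationIn hδ' he⟩⟩
        map_one' := Subtype.ext (by simp)
        map_mul' := fun ρ κ => Subtype.ext (by simp [mul_assoc]) }
    refine ⟨MonoidHom.toAdditive α, fun e u hu => ?_, ?_⟩
    · exact conj_mem_translationIn hδ' hu
    · refine congrArg Additive.ofMul (f.injective ?_)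
      rw [← hδσ]
      change δ (σ.1 (δ⁻¹ o)) = δ (σ.1 o)
      have : δ⁻¹ o = o := by rw [Equiv.Perm.inv_eq_iff_eq, hδo]
      rw [this]

end DesarguesianAffineSpace

/-! ### The division ring of direction-preserving endomorphisms -/

/-- The ring of those endomorphisms of an abelian group that preserve all subgroups of a family. -/
def preservingEnd {V D : Type*} [AddCommGroup V] (dir : D → AddSubgroup V) :
    Subring (AddMonoid.End V) where
  carrier := {α | ∀ d, ∀ v ∈ dir d, α v ∈ dir d}
  zero_mem' := fun d _ _ => zero_mem (dir d)
  one_mem' := fun _ _ hv => hv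
  add_mem' := fun hα hβ d v hv => add_mem (hα d v hv) (hβ d v hv)
  neg_mem' := fun hα d v hv => neg_mem (hα d v hv)
  mul_mem' := fun hα hβ d v hv => hα d _ (hβ d v hv)

/-- If subgroups with trivial pairwise intersections cover an abelian group, and if the
endomorphisms preserving them act transitively on the non-zero elements of each of them, then these
endomorphisms form a division ring, and the subgroups are the one-dimensional subspaces. -/
theorem exists_divisionRing {V : Type u} {D : Type*} [AddCommGroup V] (dir : D → AddSubgroup V)
    (hdisj : ∀ c d v, v ∈ dir c → v ∈ dir d → c ≠ d → v = 0)
    (hcover : ∀ v, ∃ d, v ∈ dir d)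
    (hne : ∀ d, ∃ v ∈ dir d, v ≠ 0)
    (htwo : ∀ c : D, ∃ d, c ≠ d) (hD : Nonempty D)
    (htrans : ∀ d, ∀ v ∈ dir d, ∀ w ∈ dir d, v ≠ 0 → w ≠ 0 →
        ∃ α : AddMonoid.End V, (∀ e, ∀ u ∈ dir e, α u ∈ dir e) ∧ α v = w) :
    ∃ (K : Type u) (_ : DivisionRing K) (_ : Module K V),
      ∀ d, ∀ v ∈ dir d, v ≠ 0 → ∀ w, w ∈ dir d ↔ ∃ k : K, k • v = w := by
  have hoff : ∀ α ∈ preservingEnd dir, ∀ c d v w, v ∈ dir c → w ∈ dir d → c ≠ d → v ≠ 0 →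
      α v = 0 → α w = 0 := by
    intro α hα c d v w hv hw hcd hv0 h0
    by_cases hw0 : w = 0
    · rw [hw0, map_zero]
    obtain ⟨e, he⟩ := hcover (v + w)
    have hed : e ≠ d := by
      rintro rfl
      exact hv0 (hdisj _ _ v hv (by simpa using sub_mem he hw) hcd)
    refine hdisj _ _ _ (hα d w hw) ?_ hed.symm
    have := hα e _ he
    rwa [map_add, h0, zero_add] at this
  have hinj : ∀ α ∈ preservingEnd dir, ∀ v, v ≠ 0 → α v = 0 → α = 0 := by
    intro α hα v hv0 h0
    obtain ⟨c, hc⟩ := hcover v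
    obtain ⟨d, hcd⟩ := htwo c
    obtain ⟨w, hw, hw0⟩ := hne d
    ext u
    obtain ⟨e, he⟩ := hcover u
    by_cases hce : c = e
    · subst hce
      exact hoff α hα d c w u hw he hcd.symm hw0 (hoff α hα c d v w hc hw hcd hv0 h0)
    · exact hoff α hα c e v u hc he hce hv0 h0
  have hleft : ∀ α : preservingEnd dir, α ≠ 0 → ∃ β : preservingEnd dir, β * α = 1 := by
    rintro ⟨α, hα⟩ h0
    obtain ⟨d⟩ := hD
    obtain ⟨v, hv, hv0⟩ := hne d
    have hαv : α v ≠ 0 := fun h => h0 (Subtype.ext (hinj α hα v hv0 h))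
    obtain ⟨β, hβ, h⟩ := htrans d _ (hα d v hv) _ hv hαv hv0
    refine ⟨⟨β, hβ⟩, Subtype.ext (sub_eq_zero.1 (hinj (β * α - 1)
      (sub_mem (mul_mem hβ hα) (one_mem _)) v hv0 ?_))⟩
    change β (α v) - v = 0
    rw [h, sub_self]
  have hnt : Nontrivial (preservingEnd dir) := by
    obtain ⟨d⟩ := hD
    obtain ⟨v, hv, hv0⟩ := hne d
    exact ⟨0, 1, fun h => hv0 (congrArg (fun α => α.1 v) h).symm⟩
  have hunit : ∀ α : preservingEnd dir, IsUnit α ∨ α = 0 := by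
    intro α
    by_cases hα : α = 0
    · exact Or.inr hα
    obtain ⟨β, hβ⟩ := hleft α hα
    have hβ0 : β ≠ 0 := by
      rintro rfl
      exact zero_ne_one ((zero_mul α).symm.trans hβ)
    obtain ⟨γ, hγ⟩ := hleft β hβ0
    have : γ = α := by rw [← mul_one γ, ← hβ, ← mul_assoc, hγ, one_mul]
    exact Or.inl ⟨⟨α, β, this ▸ hγ, hβ⟩, rfl⟩
  refine ⟨preservingEnd dir, DivisionRing.ofIsUnitOrEqZero hunit, inferInstanceAs
    (Module (preservingEnd dir) V), ?_⟩
  intro d v hv hv0 w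
  constructor
  · intro hw
    by_cases hw0 : w = 0
    · exact ⟨0, by rw [hw0, zero_smul]⟩
    obtain ⟨α, hα, h⟩ := htrans d v hv w hw hv0 hw0
    exact ⟨⟨α, hα⟩, h⟩
  · rintro ⟨⟨α, hα⟩, rfl⟩
    exact hα d v hv

namespace ProjectiveSpace

variable {P : Type*} {S : ProjectiveSpace P} {H : Set P}

/-! ### Coordinates -/

/-- The complement of a hyperplane of a desarguesian projective space is an affine space, whose
directions are the points of the hyperplane. -/
def affineSpace (hS : S.IsDesarguesian) (htri : ∃ x y z : P, ¬ S.Col x y z)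
    (hH : S.IsHyperplane H) : DesarguesianAffineSpace {x // x ∉ H} {x // x ∈ H} where
  par d x y := S.Col x.1 y.1 d.1
  nonempty_direction := by
    obtain ⟨x, y, z, h⟩ := htri
    obtain ⟨h, hh, -⟩ := hH.exists_col x y (not_col_ne h).1
    exact ⟨h, hh⟩
  equivalence d :=
    { refl := fun x => col_self_left ..
      symm := fun h => h.left_comm
      trans := fun {x y z} h h' =>
        h.rotate.trans₃ (fun e : y.1 = d.1 => y.2 (e ▸ d.2)) h'.right_comm (col_self_right ..) }
  exists_par_of_ne x y hxy := by
    obtain ⟨d, hd, h⟩ := hH.exists_col x.1 y.1 fun e => hxy (Subtype.ext e)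
    exact ⟨⟨d, hd⟩, h⟩
  eq_of_par x y c d hc hd hcd := by
    by_contra hxy
    exact hcd (Subtype.ext (hH.eq_of_col x.2 c.2 d.2 (fun e => hxy (Subtype.ext e)) hc hd))
  exists_not_par d x := by
    obtain ⟨q, hq, h⟩ := hH.exists_notMem_not_col htri x.2 (c := d.1) fun e => x.2 (e ▸ d.2)
    exact ⟨⟨q, hq⟩, fun h' => h h'.rotate'⟩
  exists_ne_par d x := by
    obtain ⟨y, hy, hyx, hyd⟩ := exists_third (S := S) (x := x.1) (y := d.1)
      fun e => x.2 (e ▸ d.2)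
    refine ⟨⟨y, fun hyH => x.2 (hH.isSubspace.mem hyH d.2 hyd hy.swap)⟩,
      fun e => hyx (congrArg Subtype.val e), hy.right_comm⟩
  exists_translation d x y h := by
    obtain ⟨σ, h1, h2, h3, -⟩ := exists_isDilation hS htri hH (c := d.1) (a := x) (b := y)
      (fun e => x.2 (e ▸ d.2)) (fun e => y.2 (e ▸ d.2)) h.rotate'
    exact ⟨σ, fun e => h1 e.1 e.2, fun z => (h3 z).rotate, h2⟩
  exists_homothety d o x y hx hy hxo hyo := by
    have hod : o.1 ≠ d.1 := fun e => o.2 (e ▸ d.2)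
    obtain ⟨σ, h1, h2, -, h3⟩ := exists_isDilation hS htri hH (c := o.1) (a := x) (b := y)
      (fun e => hxo (Subtype.ext e)) (fun e => hyo (Subtype.ext e))
      (hx.right_comm.trans hod hy.right_comm)
    exact ⟨σ, fun e => h1 e.1 e.2, h3 o rfl, h2⟩

/-- Homogeneous coordinates: each point is represented by a non-zero vector, up to scalars each
non-zero vector represents a point, and joins are given by spans. -/
structure Coordinates (S : ProjectiveSpace P) (K V : Type*) [DivisionRing K] [AddCommGroup V]
    [Module K V] where
  vec : P → V
  vec_ne_zero : ∀ x, vec x ≠ 0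
  exists_smul_vec : ∀ v, v ≠ 0 → ∃ x, ∃ k : K, k • vec x = v
  mem_join_iff : ∀ x y z, z ∈ S.join {x} {y} ↔ vec z ∈ Submodule.span K {vec x, vec y}

/-- The affine geometry outside a hyperplane determines the collinear triples in it. -/
theorem IsHyperplane.col_iff (hH : S.IsHyperplane H) (o : {x // x ∉ H}) {x y z : P} (hx : x ∈ H)
    (hy : y ∈ H) (hz : z ∈ H) (hxy : x ≠ y) (hzx : z ≠ x) (hzy : z ≠ y) :
    S.Col x y z ↔ ∃ p q : {x // x ∉ H}, p ≠ o ∧ q ≠ o ∧ S.Col o.1 p.1 x ∧ S.Col p.1 q.1 y ∧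
      S.Col o.1 q.1 z := by
  constructor
  · intro h
    have hox : o.1 ≠ x := fun e => o.2 (e ▸ hx)
    obtain ⟨p, hp, hpo, hpx⟩ := exists_third (S := S) hox
    have hpH : p ∉ H := fun hpH => o.2 (hH.isSubspace.mem hpH hx hpx hp.swap)
    obtain ⟨q, hq, hq'⟩ := pasch (S := S) (a := p) (b := o.1) (c := y) (d := z) (p := x)
      hp.rotate' h.rotate
    have hqH : q ∉ H := by
      intro hqH
      have h1 : q = y := by
        by_contra hne
        exact hpH (hH.isSubspace.mem hqH hy hne hq.swap)
      have h2 : q = z := by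
        by_contra hne
        exact o.2 (hH.isSubspace.mem hqH hz hne hq'.swap)
      exact hzy (h2.symm.trans h1)
    refine ⟨⟨p, hpH⟩, ⟨q, hqH⟩, fun e => hpo (congrArg Subtype.val e), fun e => hxy ?_,
      hp.right_comm, hq.right_comm, hq'.right_comm⟩
    have e' : q = o.1 := congrArg Subtype.val e
    subst e'
    exact hH.eq_of_col o.2 hx hy (Ne.symm hpo) hp.right_comm hq.rotate'
  · rintro ⟨p, q, hpo, hqo, h1, h2, h3⟩
    obtain ⟨r, hr, hr'⟩ := pasch (S := S) h1.swap h3.swap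
    have hpq : p.1 ≠ q.1 := by
      intro e
      rw [← e] at h3
      exact hzx (hH.eq_of_col o.2 hz hx (fun e => hpo (Subtype.ext e.symm)) h3 h1)
    have hry : r = y := hH.eq_of_col p.2 (hH.isSubspace.mem hx hz hzx.symm hr) hy hpq hr' h2
    exact hry ▸ hr.right_comm

/-- The theorem of Hilbert, Veblen and Young: a desarguesian projective space that is not a line
has homogeneous coordinates from a division ring. -/
theorem exists_coordinates {P : Type u} {S : ProjectiveSpace P} (hS : S.IsDesarguesian)
    (htri : ∃ x y z : P, ¬ S.Col x y z) :
    ∃ (K V : Type u) (_ : DivisionRing K) (_ : AddCommGroup V) (_ : Module K V),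
      Nonempty (Coordinates S K V) := by
  classical
  obtain ⟨o₀, -⟩ := id htri
  obtain ⟨H, hH, ho⟩ := S.exists_isHyperplane o₀
  let o : {x // x ∉ H} := ⟨o₀, ho⟩
  have : Nonempty {x // x ∉ H} := ⟨o⟩
  let 𝔸 := affineSpace hS htri hH
  obtain ⟨V, iV, t₀, dir, hpar₀, htrans⟩ := 𝔸.exists_addCommGroup
  -- The point `o` becomes the zero vector.
  let t : {x // x ∉ H} ≃ V := t₀.trans (Equiv.subRight (t₀ o))
  have hto : t o = 0 := sub_self _
  have hpar : ∀ (d : {x // x ∈ H}) (x y : {x // x ∉ H}),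
      S.Col x.1 y.1 d.1 ↔ t y - t x ∈ dir d := by
    intro d x y
    have : t y - t x = t₀ y - t₀ x := sub_sub_sub_cancel_right _ _ _
    rw [this]
    exact hpar₀ d x y
  have hparo : ∀ (d : {x // x ∈ H}) (v : V), v ∈ dir d ↔ S.Col o₀ (t.symm v).1 d.1 := by
    intro d v
    rw [hpar d o, hto, sub_zero, t.apply_symm_apply]
  have hdisj : ∀ c d v, v ∈ dir c → v ∈ dir d → c ≠ d → v = 0 := by
    intro c d v hc hd hcd
    rw [hparo] at hc hd
    have : o = t.symm v := 𝔸.eq_of_par _ _ c d hc hd hcd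
    rw [← t.apply_symm_apply v, ← this, hto]
  have hne : ∀ d, ∃ v ∈ dir d, v ≠ 0 := by
    intro d
    obtain ⟨y, hy, hy'⟩ := 𝔸.exists_ne_par d o
    refine ⟨t y, ?_, fun h => hy (t.injective (h.trans hto.symm))⟩
    rw [hparo, t.symm_apply_apply]
    exact hy'
  have hcover : ∀ v, ∃ d, v ∈ dir d := by
    intro v
    by_cases hv : v = 0
    · exact ⟨𝔸.nonempty_direction.some, hv ▸ zero_mem _⟩
    · obtain ⟨d, hd⟩ := 𝔸.exists_par_of_ne o (t.symm v)
        fun h => hv (by rw [← t.apply_symm_apply v, ← h, hto])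
      exact ⟨d, (hparo d v).2 hd⟩
  obtain ⟨K, iK, iKV, hK⟩ := exists_divisionRing dir hdisj hcover hne
    (fun c => by
      obtain ⟨y, hy⟩ := 𝔸.exists_not_par c o
      obtain ⟨d, hd⟩ := 𝔸.exists_par_of_ne o y fun h => hy (h ▸ (𝔸.equivalence c).refl o)
      exact ⟨d, fun h => hy (h ▸ hd)⟩) 𝔸.nonempty_direction htrans
  choose u hu hu0 using hne
  have hK' : ∀ d w, w ∈ dir d ↔ ∃ k : K, k • u d = w := fun d w => hK d (u d) (hu d) (hu0 d) w
  let vec : P → V × K := fun x => if hx : x ∈ H then (u ⟨x, hx⟩, 0) else (t ⟨x, hx⟩, 1)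
  have vecH : ∀ x (hx : x ∈ H), vec x = (u ⟨x, hx⟩, 0) := fun x hx => dif_pos hx
  have vecA : ∀ x (hx : x ∉ H), vec x = (t ⟨x, hx⟩, 1) := fun x hx => dif_neg hx
  refine ⟨K, V × K, iK, inferInstance, inferInstance, ⟨⟨vec, ?_, ?_, ?_⟩⟩⟩
  · intro x hx0
    by_cases hx : x ∈ H
    · rw [vecH x hx] at hx0
      exact hu0 _ (congrArg Prod.fst hx0)
    · rw [vecA x hx] at hx0
      exact one_ne_zero (congrArg Prod.snd hx0)
  · rintro ⟨v, k⟩ hv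
    by_cases hk : k = 0
    · subst hk
      obtain ⟨d, hd⟩ := hcover v
      obtain ⟨k, hk⟩ := (hK' d v).1 hd
      exact ⟨d, k, by rw [vecH d d.2, Prod.smul_mk, hk, smul_zero]⟩
    · refine ⟨(t.symm (k⁻¹ • v)).1, k, ?_⟩
      rw [vecA _ (t.symm (k⁻¹ • v)).2, Prod.smul_mk, Subtype.coe_eta, t.apply_symm_apply,
        smul_inv_smul₀ hk, smul_eq_mul, mul_one]
  · have hsing : ∀ x y, x ∈ H → y ∈ H → ∀ k : K, k • vec x = vec y → y = x := by
      intro x y hx hy k hk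
      rw [vecH x hx, vecH y hy] at hk
      by_contra hne
      exact hu0 _ (hdisj ⟨y, hy⟩ ⟨x, hx⟩ _ (hu _) ((hK' _ _).2 ⟨k, congrArg Prod.fst hk⟩)
        fun e => hne (congrArg Subtype.val e))
    have hinj : ∀ x y, vec y ∈ Submodule.span K {vec x} → y = x := by
      intro x y h
      obtain ⟨k, hk⟩ := Submodule.mem_span_singleton.1 h
      by_cases hx : x ∈ H <;> by_cases hy : y ∈ H
      · exact hsing x y hx hy k hk
      · rw [vecH x hx, vecA y hy] at hk
        simpa using congrArg Prod.snd hk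
      · rw [vecA x hx, vecH y hy] at hk
        have h2 : k = 0 := by simpa using congrArg Prod.snd hk
        have h1 := congrArg Prod.fst hk
        rw [h2, zero_smul] at h1
        exact absurd h1.symm (hu0 _)
      · rw [vecA x hx, vecA y hy] at hk
        have h2 : k = 1 := by simpa using congrArg Prod.snd hk
        have h1 := congrArg Prod.fst hk
        rw [h2, one_smul] at h1
        exact (congrArg Subtype.val (t.injective h1)).symm
    have main : ∀ x y z, x ≠ y → (x ∈ H → y ∈ H) →
        (S.Col x y z ↔ ∃ a b : K, a • vec x + b • vec y = vec z) := by
      intro x y z hxy himp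
      by_cases hx : x ∈ H
      · have hy := himp hx
        by_cases hz : z ∈ H
        · by_cases hzx : z = x
          · subst hzx
            exact ⟨fun _ => ⟨1, 0, by simp⟩, fun _ => col_self_outer ..⟩
          by_cases hzy : z = y
          · subst hzy
            exact ⟨fun _ => ⟨0, 1, by simp⟩, fun _ => col_self_right ..⟩
          rw [hH.col_iff o hx hy hz hxy hzx hzy, vecH x hx, vecH y hy, vecH z hz]
          constructor
          · rintro ⟨p, q, -, hq, h1, h2, h3⟩
            rw [hpar ⟨x, hx⟩, hto, sub_zero, hK'] at h1
            rw [hpar ⟨y, hy⟩, hK'] at h2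
            rw [hpar ⟨z, hz⟩, hto, sub_zero] at h3
            obtain ⟨a, ha⟩ := h1
            obtain ⟨b, hb⟩ := h2
            obtain ⟨k, hk⟩ := (hK _ _ h3 fun e => hq (t.injective (e.trans hto.symm)) ) _ |>.1
              (hu ⟨z, hz⟩)
            refine ⟨k * a, k * b, Prod.ext ?_ (by simp)⟩
            change (k * a) • u ⟨x, hx⟩ + (k * b) • u ⟨y, hy⟩ = u ⟨z, hz⟩
            rw [mul_smul, mul_smul, ha, hb, ← smul_add, add_sub_cancel, hk]
          · rintro ⟨a, b, hab⟩
            have h : a • u ⟨x, hx⟩ + b • u ⟨y, hy⟩ = u ⟨z, hz⟩ := congrArg Prod.fst hab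
            have ha : a • u ⟨x, hx⟩ ≠ 0 := fun e => by
              rw [e, zero_add] at h
              refine hzy (hsing y z hy hz b ?_)
              rw [vecH y hy, vecH z hz, Prod.smul_mk, h, smul_zero]
            refine ⟨t.symm (a • u ⟨x, hx⟩), t.symm (u ⟨z, hz⟩), ?_, ?_, ?_, ?_, ?_⟩
            · rwa [ne_eq, Equiv.symm_apply_eq, hto]
            · rw [ne_eq, Equiv.symm_apply_eq, hto]
              exact hu0 _
            · exact (hparo ⟨x, hx⟩ _).1 ((hK' _ _).2 ⟨a, rfl⟩)
            · rw [hpar ⟨y, hy⟩, t.apply_symm_apply, t.apply_symm_apply, ← h, add_sub_cancel_left]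
              exact (hK' _ _).2 ⟨b, rfl⟩
            · exact (hparo ⟨z, hz⟩ _).1 (hu _)
        · rw [vecH x hx, vecH y hy, vecA z hz]
          refine ⟨fun h => absurd (hH.isSubspace.mem hx hy hxy h) hz, ?_⟩
          rintro ⟨a, b, hab⟩
          simpa using congrArg Prod.snd hab
      · by_cases hy : y ∈ H
        · rw [vecA x hx, vecH y hy]
          by_cases hz : z ∈ H
          · rw [vecH z hz]
            constructor
            · intro h
              obtain rfl := hH.eq_of_col hx hy hz hxy (col_self_right ..) h
              exact ⟨0, 1, by simp⟩
            · rintro ⟨a, b, hab⟩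
              have h2 : a = 0 := by simpa using congrArg Prod.snd hab
              have h1 := congrArg Prod.fst hab
              rw [h2, zero_smul, zero_add] at h1
              have : z = y := hsing y z hy hz b (by
                rw [vecH y hy, vecH z hz]; exact Prod.ext h1 (smul_zero _))
              exact this ▸ col_self_right ..
          · rw [vecA z hz, show S.Col x y z ↔ S.Col x z y from ⟨Col.right_comm, Col.right_comm⟩,
              hpar ⟨y, hy⟩ ⟨x, hx⟩ ⟨z, hz⟩, hK']
            constructor
            · rintro ⟨k, hk⟩
              exact ⟨1, k, Prod.ext (by simp [hk]) (by simp)⟩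
            · rintro ⟨a, b, hab⟩
              have h2 : a = 1 := by simpa using congrArg Prod.snd hab
              have h1 : a • t ⟨x, hx⟩ + b • u ⟨y, hy⟩ = t ⟨z, hz⟩ := congrArg Prod.fst hab
              exact ⟨b, by rw [← h1, h2, one_smul, add_sub_cancel_left]⟩
        · rw [vecA x hx, vecA y hy]
          have hne' : t ⟨y, hy⟩ - t ⟨x, hx⟩ ≠ 0 := fun e =>
            hxy (congrArg Subtype.val (t.injective (sub_eq_zero.1 e))).symm
          by_cases hz : z ∈ H
          · rw [vecH z hz, hpar ⟨z, hz⟩ ⟨x, hx⟩ ⟨y, hy⟩]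
            constructor
            · intro h
              obtain ⟨k, hk⟩ := (hK _ _ h hne' _).1 (hu ⟨z, hz⟩)
              exact ⟨-k, k, Prod.ext (by simp [← hk, sub_eq_neg_add]) (by simp)⟩
            · rintro ⟨a, b, hab⟩
              have h2 : a + b = 0 := by simpa using congrArg Prod.snd hab
              have h1 : a • t ⟨x, hx⟩ + b • t ⟨y, hy⟩ = u ⟨z, hz⟩ := congrArg Prod.fst hab
              rw [eq_neg_of_add_eq_zero_left h2, neg_smul, neg_add_eq_sub, ← smul_sub] at h1
              have hb : b ≠ 0 := fun e => hu0 ⟨z, hz⟩ (by rw [← h1, e, zero_smul])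
              exact (hK' _ _).2 ⟨b⁻¹, by rw [← h1, inv_smul_smul₀ hb]⟩
          · rw [vecA z hz]
            obtain ⟨d, hd, hxyd⟩ := hH.exists_col x y hxy
            have hxd : x ≠ d := fun e => hx (e ▸ hd)
            have : S.Col x y z ↔ S.Col x z d :=
              ⟨fun h => h.trans hxy hxyd,
                fun h => hxyd.right_comm.trans hxd h.right_comm⟩
            rw [this, hpar ⟨d, hd⟩ ⟨x, hx⟩ ⟨z, hz⟩,
              hK _ _ ((hpar ⟨d, hd⟩ ⟨x, hx⟩ ⟨y, hy⟩).1 hxyd) hne']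
            constructor
            · rintro ⟨k, hk⟩
              refine ⟨1 - k, k, Prod.ext ?_ (by simp)⟩
              change (1 - k) • t ⟨x, hx⟩ + k • t ⟨y, hy⟩ = t ⟨z, hz⟩
              rw [sub_smul, one_smul, ← sub_eq_zero, ← sub_eq_zero.2 hk, smul_sub]
              abel
            · rintro ⟨a, b, hab⟩
              have h2 : a + b = 1 := by simpa using congrArg Prod.snd hab
              have h1 : a • t ⟨x, hx⟩ + b • t ⟨y, hy⟩ = t ⟨z, hz⟩ := congrArg Prod.fst hab
              refine ⟨b, ?_⟩
              rw [← h1, eq_sub_of_add_eq h2, sub_smul, one_smul, smul_sub]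
              abel
    intro x y z
    by_cases hxy : x = y
    · subst hxy
      rw [join_self, Set.mem_singleton_iff, Set.pair_eq_singleton]
      exact ⟨fun h => h ▸ Submodule.mem_span_singleton_self _, hinj x z⟩
    rw [mem_join_iff_col hxy, Submodule.mem_span_pair]
    by_cases himp : x ∈ H → y ∈ H
    · exact main x y z hxy himp
    · have hx : x ∈ H := by
        by_contra hx
        exact himp fun h => absurd h hx
      rw [show S.Col x y z ↔ S.Col y x z from ⟨Col.left_comm, Col.left_comm⟩,
        main y x z (Ne.symm hxy) fun _ => hx, exists_comm]
      simp only [add_comm]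

end ProjectiveSpace

/-! ### The fundamental theorem for maps to one-dimensional subspaces -/

section FundamentalTheorem

open Submodule

theorem eq_zero_of_smul_add_smul_add_smul {K V : Type*} [DivisionRing K] [AddCommGroup V]
    [Module K V] {p q r : V} (hp : p ≠ 0) (hq : q ∉ span K {p}) (hr : r ∉ span K {p} ⊔ span K {q})
    {α β γ : K} (h : α • p + β • q + γ • r = 0) : α = 0 ∧ β = 0 ∧ γ = 0 := by
  have hγ : γ = 0 := by
    by_contra hγ
    refine hr ?_
    rw [← inv_smul_smul₀ hγ r, eq_neg_of_add_eq_zero_right h]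
    exact smul_mem _ _ (neg_mem (add_mem
      (mem_sup_left (smul_mem _ _ (mem_span_singleton_self p)))
      (mem_sup_right (smul_mem _ _ (mem_span_singleton_self q)))))
  rw [hγ, zero_smul, add_zero] at h
  have hβ : β = 0 := by
    by_contra hβ
    refine hq ?_
    rw [← inv_smul_smul₀ hβ q, eq_neg_of_add_eq_zero_right h]
    exact smul_mem _ _ (neg_mem (smul_mem _ _ (mem_span_singleton_self p)))
  rw [hβ, zero_smul, add_zero] at h
  exact ⟨(smul_eq_zero.1 h).resolve_right hp, hβ, hγ⟩

/-- A map from a vector space to the subspaces of dimension at most one of another vector space,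
as it is given by a weak linear mapping of the projective spaces whose image is not contained in a
line. -/
structure IsProjectiveMap {K K' V V' : Type*} [DivisionRing K] [DivisionRing K'] [AddCommGroup V]
    [AddCommGroup V'] [Module K V] [Module K' V'] (g : V → Submodule K' V') : Prop where
  exists_eq_span : ∀ v, ∃ w, g v = span K' {w}
  map_smul : ∀ (k : K) (v : V), k ≠ 0 → g (k • v) = g v
  map_add : ∀ v w, g (v + w) ≤ g v ⊔ g w
  exists_not_le : ∀ v w, ∃ b, ¬ g b ≤ g v ⊔ g w

namespace IsProjectiveMap

variable {K K' V V' : Type*} [DivisionRing K] [DivisionRing K'] [AddCommGroup V]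
    [AddCommGroup V'] [Module K V] [Module K' V'] {g : V → Submodule K' V'}

section
variable (hg : IsProjectiveMap (K := K) g)
include hg

theorem eq_span {x : V} {v : V'} (hv : v ∈ g x) (h0 : v ≠ 0) : g x = span K' {v} := by
  obtain ⟨w, hw⟩ := hg.exists_eq_span x
  rw [hw] at hv ⊢
  obtain ⟨k, rfl⟩ := mem_span_singleton.1 hv
  have hk : k ≠ 0 := fun e => h0 (by rw [e, zero_smul])
  exact (span_singleton_smul_eq (IsUnit.mk0 k hk) w).symm

theorem le_of_mem {x : V} {v : V'} {U : Submodule K' V'} (hv : v ∈ g x) (h0 : v ≠ 0)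
    (hU : v ∈ U) : g x ≤ U := by
  rw [hg.eq_span hv h0]
  exact (span_singleton_le_iff_mem _ _).2 hU

theorem map_neg (x : V) : g (-x) = g x := by
  rw [← neg_one_smul K x, hg.map_smul _ _ (neg_ne_zero.2 one_ne_zero)]

theorem le_sup_left (x y : V) : g x ≤ g (x + y) ⊔ g y := by
  have := hg.map_add (x + y) (-y)
  rwa [add_neg_cancel_right, hg.map_neg] at this

theorem le_sup_right (x y : V) : g y ≤ g (x + y) ⊔ g x := by
  rw [add_comm x y]; exact hg.le_sup_left y x

variable {a : V} {a' : V'} (ha : a' ∈ g a) (ha0 : a' ≠ 0)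
include ha ha0

theorem not_le_left {x : V} (hx : ¬ g x ≤ g a) : ¬ g (a + x) ≤ g x := fun h => by
  have h1 : g a ≤ g x := (hg.le_sup_left a x).trans (sup_le h le_rfl)
  exact hx (hg.eq_span (h1 ha) ha0 ▸ (hg.eq_span ha ha0).ge)

/-- The lift of a point `x` that is not sent to the image of `a`: it is normalized by means of the
image of `a + x`. -/
theorem exists_lift {x : V} (hx : ¬ g x ≤ g a) : ∃ v ∈ g x, a' + v ∈ g (a + x) := by
  obtain ⟨w, hw⟩ := hg.exists_eq_span x
  obtain ⟨z, hz⟩ := hg.exists_eq_span (a + x)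
  have h1 : z ∈ g a ⊔ g x := hg.map_add a x (hz ▸ mem_span_singleton_self z)
  rw [hg.eq_span ha ha0, hw, mem_sup] at h1
  obtain ⟨p, hp, q, hq, h⟩ := h1
  obtain ⟨α, rfl⟩ := mem_span_singleton.1 hp
  have hα : α ≠ 0 := by
    rintro rfl
    refine hg.not_le_left ha ha0 hx ?_
    rw [hz, hw, span_singleton_le_iff_mem, ← h, zero_smul, zero_add]
    exact hq
  refine ⟨α⁻¹ • q, hw ▸ smul_mem _ _ hq, ?_⟩
  rw [← inv_smul_smul₀ hα a', ← smul_add, h, hz]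
  exact smul_mem _ _ (mem_span_singleton_self z)

theorem lift_unique {x : V} (hx : ¬ g x ≤ g a) {v w : V'} (hv : v ∈ g x) (hw : w ∈ g x)
    (hv' : a' + v ∈ g (a + x)) (hw' : a' + w ∈ g (a + x)) : v = w := by
  by_contra hne
  have h0 : v - w ≠ 0 := sub_ne_zero.2 hne
  have h1 : v - w ∈ g (a + x) := by simpa using sub_mem hv' hw'
  exact hg.not_le_left ha ha0 hx (hg.le_of_mem h1 h0 (sub_mem hv hw))

theorem lift_ne_zero {x : V} (hx : ¬ g x ≤ g a) {v : V'} (hv' : a' + v ∈ g (a + x)) :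
    v ≠ 0 := by
  rintro rfl
  rw [add_zero] at hv'
  have h1 : g (a + x) ≤ g a := hg.le_of_mem hv' ha0 ha
  exact hx ((hg.le_sup_right a x).trans (sup_le h1 le_rfl))

theorem lift_add {x y : V} (hx : ¬ g x ≤ g a) (hy : ¬ g y ≤ g a ⊔ g x) {v w : V'} (hv : v ∈ g x)
    (hw : w ∈ g y) (hv' : a' + v ∈ g (a + x)) (hw' : a' + w ∈ g (a + y)) :
    v + w ∈ g (x + y) ∧ a' + (v + w) ∈ g (a + (x + y)) := by
  have hya : ¬ g y ≤ g a := fun h => hy (h.trans _root_.le_sup_left)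
  have hv0 := hg.lift_ne_zero ha ha0 hx hv'
  have hw0 := hg.lift_ne_zero ha ha0 hya hw'
  have ega := hg.eq_span ha ha0
  have egx := hg.eq_span hv hv0
  have egy := hg.eq_span hw hw0
  have hva : v ∉ span K' {a'} := fun h => hx (hg.le_of_mem hv hv0 (ega ▸ h))
  have hwa : w ∉ span K' {a'} ⊔ span K' {v} :=
    fun h => hy (hg.le_of_mem hw hw0 (by rw [ega, egx]; exact h))
  have hav0 : a' + v ≠ 0 := fun h => hva (by
    rw [eq_neg_of_add_eq_zero_right h]; exact neg_mem (mem_span_singleton_self _))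
  have haw0 : a' + w ≠ 0 := fun h => hwa (by
    rw [eq_neg_of_add_eq_zero_right h]
    exact mem_sup_left (neg_mem (mem_span_singleton_self _)))
  have egax := hg.eq_span hv' hav0
  have egay := hg.eq_span hw' haw0
  have key : a' + (v + w) ∈ g (a + (x + y)) := by
    obtain ⟨z, hz⟩ := hg.exists_eq_span (a + (x + y))
    have hzz : z ∈ g (a + (x + y)) := hz ▸ mem_span_singleton_self z
    have h1 : z ∈ g (a + x) ⊔ g y := hg.map_add _ _ (by rwa [add_assoc])
    have h2 : z ∈ g (a + y) ⊔ g x := hg.map_add _ _ (by rwa [add_assoc, add_comm y x])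
    rw [egax, egy, mem_sup] at h1
    rw [egay, egx, mem_sup] at h2
    obtain ⟨_, hp, _, hq, h1⟩ := h1
    obtain ⟨_, hr, _, hs, h2⟩ := h2
    obtain ⟨α, rfl⟩ := mem_span_singleton.1 hp
    obtain ⟨β, rfl⟩ := mem_span_singleton.1 hq
    obtain ⟨γ, rfl⟩ := mem_span_singleton.1 hr
    obtain ⟨δ, rfl⟩ := mem_span_singleton.1 hs
    obtain ⟨e1, e2, e3⟩ := eq_zero_of_smul_add_smul_add_smul ha0 hva hwa
      (α := α - γ) (β := α - δ) (γ := β - γ) (by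
        rw [← sub_eq_zero.2 (h1.trans h2.symm)]
        simp only [smul_add, sub_smul]
        abel)
    rw [sub_eq_zero] at e1 e2 e3
    subst e1 e3
    have hα : β ≠ 0 := by
      rintro rfl
      rw [zero_smul, zero_smul, add_zero] at h1
      rw [← h1, span_zero_singleton] at hz
      have := hg.le_sup_right (a + x) y
      rw [add_assoc, hz, bot_sup_eq] at this
      exact hy (this.trans (hg.map_add a x))
    have h3 : β⁻¹ • z = a' + (v + w) := by
      rw [← h1, ← smul_add, inv_smul_smul₀ hα, add_assoc]
    exact h3 ▸ smul_mem _ _ hzz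
  refine ⟨?_, key⟩
  have hk0 : a' + (v + w) ≠ 0 := fun h => by
    have := (eq_zero_of_smul_add_smul_add_smul (K := K') ha0 hva hwa (α := 1) (β := 1) (γ := 1)
      (by simpa [add_assoc] using h)).1
    exact one_ne_zero this
  have egaxy := hg.eq_span key hk0
  obtain ⟨z, hz⟩ := hg.exists_eq_span (x + y)
  have hzz : z ∈ g (x + y) := hz ▸ mem_span_singleton_self z
  have h1 : z ∈ g x ⊔ g y := hg.map_add _ _ hzz
  have h2 : z ∈ g (a + (x + y)) ⊔ g a := hg.le_sup_right a (x + y) hzz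
  rw [egx, egy, mem_sup] at h1
  rw [egaxy, ega, mem_sup] at h2
  obtain ⟨_, hp, _, hq, h1⟩ := h1
  obtain ⟨_, hr, _, hs, h2⟩ := h2
  obtain ⟨α, rfl⟩ := mem_span_singleton.1 hp
  obtain ⟨β, rfl⟩ := mem_span_singleton.1 hq
  obtain ⟨γ, rfl⟩ := mem_span_singleton.1 hr
  obtain ⟨δ, rfl⟩ := mem_span_singleton.1 hs
  obtain ⟨-, e2, e3⟩ := eq_zero_of_smul_add_smul_add_smul ha0 hva hwa
    (α := -γ - δ) (β := α - γ) (γ := β - γ) (by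
      rw [← sub_eq_zero.2 (h1.trans h2.symm)]
      simp only [smul_add, sub_smul, neg_smul]
      abel)
  rw [sub_eq_zero] at e2 e3
  subst e2 e3
  have hα : β ≠ 0 := by
    rintro rfl
    rw [zero_smul, zero_smul, add_zero] at h1
    rw [← h1, span_zero_singleton] at hz
    have := hg.le_sup_right x y
    rw [hz, bot_sup_eq] at this
    exact hy (this.trans _root_.le_sup_right)
  rw [← inv_smul_smul₀ hα (v + w), smul_add β, h1]
  exact smul_mem _ _ hzz

omit ha ha0 in
/-- A projective map comes from an additive map. -/
theorem exists_addMonoidHom : ∃ F : V →+ V', ∀ x, g x = span K' {F x} := by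
  obtain ⟨a, ha⟩ := hg.exists_not_le 0 0
  obtain ⟨a', ha', ha0⟩ : ∃ a' ∈ g a, a' ≠ 0 := by
    by_contra! h
    exact ha fun v hv => h v hv ▸ zero_mem _
  clear ha
  have hex : ∀ x, ∃ v, ¬ g x ≤ g a → v ∈ g x ∧ a' + v ∈ g (a + x) := by
    intro x
    by_cases hx : g x ≤ g a
    · exact ⟨0, fun h => absurd hx h⟩
    · obtain ⟨v, hv⟩ := hg.exists_lift ha' ha0 hx
      exact ⟨v, fun _ => hv⟩
  choose f hf using hex
  have hnot : ∀ {x y}, ¬ g y ≤ g a ⊔ g x → ¬ g y ≤ g a :=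
    fun h h' => h (h'.trans _root_.le_sup_left)
  -- A point added to a point outside a subspace stays outside.
  have hout : ∀ {x b} {U : Submodule K' V'}, ¬ g b ≤ U → g x ≤ U → ¬ g (x + b) ≤ U :=
    fun hb hx h => hb ((hg.le_sup_right _ _).trans (sup_le h hx))
  have fadd : ∀ {x y}, ¬ g x ≤ g a → ¬ g y ≤ g a ⊔ g x → f (x + y) = f x + f y := by
    intro x y hx hy
    obtain ⟨h1, h2⟩ := hg.lift_add ha' ha0 hx hy (hf x hx).1 (hf y (hnot hy)).1 (hf x hx).2
      (hf y (hnot hy)).2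
    have hxy : ¬ g (x + y) ≤ g a := fun h => hy <|
      (hg.le_sup_right x y).trans (sup_le_sup h le_rfl)
    exact hg.lift_unique ha' ha0 hxy (hf _ hxy).1 h1 (hf _ hxy).2 h2
  choose b hb using fun x => hg.exists_not_le a x
  let F : V → V' := fun x => f (x + b x) - f (b x)
  have hF1 : ∀ x, ¬ g x ≤ g a → F x = f x := fun x hx =>
    sub_eq_of_eq_add (fadd hx (hb x))
  -- Two auxiliary points in general position define the same value.
  have hstep : ∀ {x c d}, g x ≤ g a → ¬ g c ≤ g a → ¬ g d ≤ g a ⊔ g c →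
      f (x + c) - f c = f (x + d) - f d := by
    intro x c d hx hc hd
    have hd' : ¬ g d ≤ g a := hnot hd
    have hc' : ¬ g c ≤ g a ⊔ g (x + d) := by
      intro h
      have h1 : f c ∈ g a ⊔ g d :=
        h.trans (sup_le _root_.le_sup_left ((hg.map_add x d).trans (sup_le_sup hx le_rfl)))
          (hf c hc).1
      obtain ⟨p, hp, q, hq, hpq⟩ := mem_sup.1 h1
      have hq0 : q ≠ 0 := by
        rintro rfl
        rw [add_zero] at hpq
        exact hc (hg.le_of_mem (hf c hc).1 (hg.lift_ne_zero ha' ha0 hc (hf c hc).2) (hpq ▸ hp))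
      refine hd (hg.le_of_mem hq hq0 ?_)
      rw [← sub_eq_of_eq_add' hpq.symm, sub_eq_neg_add]
      exact add_mem (mem_sup_left (neg_mem hp)) (mem_sup_right (hf c hc).1)
    have h1 : f (x + c + d) = f (x + c) + f d :=
      fadd (hout hc hx) fun h => hd (h.trans (sup_le _root_.le_sup_left
        ((hg.map_add x c).trans (sup_le_sup hx le_rfl))))
    have h2 : f (x + d + c) = f (x + d) + f c := fadd (hout hd' hx) hc'
    rw [add_right_comm] at h2
    rw [sub_eq_sub_iff_add_eq_add, ← h1, h2]
  have hF : ∀ x c, ¬ g c ≤ g a ⊔ g x → F x = f (x + c) - f c := by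
    intro x c hc
    by_cases hx : g x ≤ g a
    · have hbx := hnot (hb x)
      by_cases h : g c ≤ g a ⊔ g (b x)
      · obtain ⟨d, hd⟩ := hg.exists_not_le a (b x)
        exact (hstep hx hbx hd).trans (hstep hx (hnot hc) fun h' =>
          hd (h'.trans (sup_le _root_.le_sup_left h))).symm
      · exact hstep hx hbx h
    · rw [hF1 x hx, fadd hx hc, add_sub_cancel_right]
  have hFadd' : ∀ x y c, ¬ g c ≤ g a ⊔ g x ⊔ g y → F (x + y) = F x + F y := by
    intro x y c hc
    rw [hF (x + y) c fun h => hc (h.trans (sup_le (_root_.le_sup_left.trans _root_.le_sup_left)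
        ((hg.map_add x y).trans (sup_le_sup_right _root_.le_sup_right _)))),
      hF x (y + c) fun h => hout hc _root_.le_sup_right (h.trans _root_.le_sup_left),
      hF y c fun h => hc (h.trans (sup_le_sup_right _root_.le_sup_left _)), add_assoc,
      sub_add_sub_cancel]
  have hFadd : ∀ x y, F (x + y) = F x + F y := by
    intro x y
    by_cases hy : g y ≤ g a ⊔ g x
    · obtain ⟨c, hc⟩ := hg.exists_not_le a x
      exact hFadd' x y c (by rwa [sup_eq_left.2 hy])
    by_cases hx : g x ≤ g a
    · obtain ⟨c, hc⟩ := hg.exists_not_le a y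
      exact hFadd' x y c (by rwa [sup_eq_left.2 hx])
    · have hxy : ¬ g (x + y) ≤ g a := fun h => hy <|
        (hg.le_sup_right x y).trans (sup_le_sup h le_rfl)
      rw [hF1 _ hxy, hF1 _ hx, hF1 _ (hnot hy), fadd hx hy]
  have hFmem : ∀ x, F x ∈ g x := by
    intro x
    by_cases hx : g x ≤ g a
    · have hval : ∀ c, ¬ g c ≤ g a → F x ∈ g x ⊔ g c := by
        intro c hc
        rw [hF x c (by rwa [sup_eq_left.2 hx])]
        exact sub_mem (hg.map_add x c (hf _ (hout hc hx)).1) (mem_sup_right (hf c hc).1)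
      obtain ⟨c, hc⟩ := hg.exists_not_le a (b x)
      obtain ⟨p, hp, q, hq, hpq⟩ := mem_sup.1 (hval c (hnot hc))
      have hq0 : q = 0 := by
        by_contra hq0
        refine hc (hg.le_of_mem hq hq0 ?_)
        rw [← sub_eq_of_eq_add' hpq.symm]
        exact sub_mem (sup_le_sup_right hx _ (hval _ (hnot (hb x)))) (mem_sup_left (hx hp))
      rw [← hpq, hq0, add_zero]
      exact hp
    · rw [hF1 x hx]; exact (hf x hx).1
  refine ⟨AddMonoidHom.mk' F hFadd, fun x => ?_⟩
  change g x = span K' {F x}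
  by_cases h0 : F x = 0
  · rw [h0, span_zero_singleton]
    by_cases hx : g x ≤ g a
    · have hbx := hnot (hb x)
      have h1 : f (x + b x) = f (b x) := sub_eq_zero.1 h0
      have hfb := hg.lift_ne_zero ha' ha0 hbx (hf _ hbx).2
      have h2 : g (x + b x) ≤ g (b x) :=
        hg.le_of_mem (hf _ (hout hbx hx)).1 (h1 ▸ hfb) (h1 ▸ (hf _ hbx).1)
      have h3 : g x ≤ g (b x) := (hg.le_sup_left x (b x)).trans (sup_le h2 le_rfl)
      by_contra hne
      obtain ⟨w, hw, hw0⟩ := (Submodule.ne_bot_iff _).1 hne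
      exact hbx (hg.le_of_mem (h3 hw) hw0 (hx hw))
    · rw [hF1 x hx] at h0
      exact absurd h0 (hg.lift_ne_zero ha' ha0 hx (hf x hx).2)
  · exact hg.eq_span (hFmem x) h0

omit ha ha0 in
/-- The fundamental theorem: a projective map comes from a semilinear map. -/
theorem exists_semilinearMap :
    ∃ (σ : K →+* K') (F : V →ₛₗ[σ] V'), ∀ x, g x = span K' {F x} := by
  obtain ⟨F, hF⟩ := hg.exists_addMonoidHom
  have hex : ∀ (k : K) x, ∃ s : K', F (k • x) = s • F x := by
    intro k x
    by_cases hk : k = 0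
    · exact ⟨0, by rw [hk, zero_smul, zero_smul, F.map_zero]⟩
    · have := hg.map_smul k x hk
      rw [hF, hF x] at this
      obtain ⟨s, hs⟩ := mem_span_singleton.1 (this ▸ mem_span_singleton_self (F (k • x)))
      exact ⟨s, hs.symm⟩
  have hindep : ∀ (k : K) x y (s r : K'), F x ≠ 0 → ¬ g y ≤ g x → F (k • x) = s • F x →
      F (k • y) = r • F y → s = r := by
    intro k x y s r hx hy hs hr
    obtain ⟨t, ht⟩ := hex k (x + y)
    rw [smul_add, F.map_add, F.map_add, hs, hr] at ht
    have hz : (s - t) • F x + (r - t) • F y = 0 := by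
      rw [sub_smul, sub_smul, sub_add_sub_comm, ht, smul_add, sub_self]
    have hrt : r = t := by
      by_contra hne
      refine hy ?_
      rw [hF y, span_singleton_le_iff_mem, hF x, ← inv_smul_smul₀ (sub_ne_zero.2 hne) (F y),
        eq_neg_of_add_eq_zero_right hz]
      exact smul_mem _ _ (neg_mem (smul_mem _ _ (mem_span_singleton_self _)))
    rw [hrt, sub_self, zero_smul, add_zero, smul_eq_zero, sub_eq_zero] at hz
    rw [hrt, hz.resolve_right hx]
  have hne : ∀ {x y}, ¬ g y ≤ g x → F y ≠ 0 := by
    intro x y h h0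
    rw [hF y, h0, span_zero_singleton] at h
    exact h bot_le
  obtain ⟨x₀, hx₀⟩ := hg.exists_not_le 0 0
  have h0 : F x₀ ≠ 0 := hne (x := 0) fun h => hx₀ (h.trans _root_.le_sup_left)
  choose s hs using fun k => hex k x₀
  have hs' : ∀ k x, F (k • x) = s k • F x := by
    intro k x
    by_cases hx : F x = 0
    · obtain ⟨r, hr⟩ := hex k x
      rw [hr, hx, smul_zero, smul_zero]
    · obtain ⟨z, hz⟩ := hg.exists_not_le x x₀
      obtain ⟨t, ht⟩ := hex k z
      obtain ⟨r, hr⟩ := hex k x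
      rw [hr, hindep k x z r t hx (fun h => hz (h.trans _root_.le_sup_left)) hr ht,
        hindep k x₀ z (s k) t h0 (fun h => hz (h.trans _root_.le_sup_right)) (hs k) ht]
  have hcancel : ∀ {k l : K'}, k • F x₀ = l • F x₀ → k = l := fun h => by
    rw [← sub_eq_zero, ← sub_smul] at h
    exact sub_eq_zero.1 ((smul_eq_zero.1 h).resolve_right h0)
  let σ : K →+* K' :=
    { toFun := s
      map_one' := hcancel (by rw [← hs', one_smul, one_smul])
      map_mul' := fun k l => hcancel (by rw [← hs', mul_smul, hs', hs', mul_smul])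
      map_zero' := hcancel (by rw [← hs', zero_smul, zero_smul, F.map_zero])
      map_add' := fun k l => hcancel (by rw [← hs', add_smul, F.map_add, hs', hs', add_smul]) }
  exact ⟨σ, { toFun := F, map_add' := F.map_add, map_smul' := hs' }, hF⟩

end

end IsProjectiveMap
end FundamentalTheorem

theorem span_pair_le_span_pair {K V : Type*} [DivisionRing K] [AddCommGroup V] [Module K V]
    {v w p q : V} (hp : p ∈ Submodule.span K {v, w}) (hq : q ∈ Submodule.span K {v, w})
    (hp0 : p ≠ 0) (hpq : q ∉ Submodule.span K {p}) :
    Submodule.span K {v, w} ≤ Submodule.span K {p, q} := by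
  by_cases h : p ∈ Submodule.span K {w}
  · obtain ⟨k, rfl⟩ := Submodule.mem_span_singleton.1 h
    have hk : k ≠ 0 := fun e => hp0 (by rw [e, zero_smul])
    have hw : w ∈ Submodule.span K {k • w} := by
      rw [Submodule.span_singleton_smul_eq (IsUnit.mk0 k hk)]
      exact Submodule.mem_span_singleton_self w
    rw [Submodule.span_insert, Submodule.span_singleton_smul_eq (IsUnit.mk0 k hk) w |>.symm,
      ← Submodule.span_insert] at hq
    have := mem_span_insert_exchange hq hpq
    rw [Set.pair_comm] at this
    rw [Submodule.span_le, Set.insert_subset_iff, Set.singleton_subset_iff]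
    exact ⟨this, Submodule.span_mono (by simp) hw⟩
  · have hv := mem_span_insert_exchange hp h
    have hle : Submodule.span K {v, w} ≤ Submodule.span K {w, p} := by
      rw [Submodule.span_le, Set.insert_subset_iff, Set.singleton_subset_iff, Set.pair_comm]
      exact ⟨hv, Submodule.subset_span (by simp)⟩
    have hw := mem_span_insert_exchange (hle hq) hpq
    refine hle.trans ?_
    rw [Submodule.span_le, Set.insert_subset_iff, Set.singleton_subset_iff, Set.pair_comm]
    exact ⟨hw, Submodule.subset_span (by simp)⟩

namespace ProjectiveSpace

/-! ### Projective spaces of vector spaces -/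

section Projectivization

open LinearAlgebra.Projectivization

variable (K V : Type*) [DivisionRing K] [AddCommGroup V] [Module K V]

variable {K V} in
theorem eq_of_rep_mem_span {x y : ℙ K V} (h : y.rep ∈ Submodule.span K {x.rep}) : y = x := by
  obtain ⟨k, hk⟩ := Submodule.mem_span_singleton.1 h
  rw [← x.mk_rep, ← y.mk_rep, Projectivization.mk_eq_mk_iff']
  exact ⟨k, hk⟩

variable {K V} in
theorem exists_smul_rep {v : V} (hv : v ≠ 0) : ∃ (x : ℙ K V) (k : K), k • x.rep = v := by
  obtain ⟨k, hk⟩ := Projectivization.exists_smul_eq_mk_rep K v hv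
  exact ⟨_, ((k⁻¹ : Kˣ) : K), by rw [← hk]; exact inv_smul_smul k v⟩

variable {K V} in
/-- Two different points of a span of two points span it. -/
theorem setOf_rep_mem_span_eq {p q x y : ℙ K V} (hxy : x ≠ y)
    (hx : x.rep ∈ Submodule.span K {p.rep, q.rep}) (hy : y.rep ∈ Submodule.span K {p.rep, q.rep}) :
    {z : ℙ K V | z.rep ∈ Submodule.span K {p.rep, q.rep}} =
      {z | z.rep ∈ Submodule.span K {x.rep, y.rep}} := by
  have h1 := span_pair_le_span_pair hx hy x.rep_nonzero fun h => hxy (eq_of_rep_mem_span h).symm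
  have h2 : Submodule.span K {x.rep, y.rep} ≤ Submodule.span K {p.rep, q.rep} := by
    rw [Submodule.span_le, Set.insert_subset_iff, Set.singleton_subset_iff]
    exact ⟨hx, hy⟩
  rw [h1.antisymm h2]

variable {K V} in
theorem eq_zero_of_smul_eq_smul {a b : ℙ K V} (hab : a ≠ b) {k l : K}
    (h : k • a.rep = l • b.rep) : k = 0 := by
  by_contra hk
  refine hab (eq_of_rep_mem_span (Submodule.mem_span_singleton.2 ⟨k⁻¹ * l, ?_⟩))
  rw [mul_smul, ← h, inv_smul_smul₀ hk]

/-- The projective space on a vector space. The points of a line are those of the span of two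
different points. -/
def ofVectorSpace : ProjectiveSpace (ℙ K V) where
  lines := {l | ∃ x y : ℙ K V, x ≠ y ∧ l = {z | z.rep ∈ Submodule.span K {x.rep, y.rep}}}
  exists_unique_line x y hxy := by
    refine ⟨_, ⟨⟨x, y, hxy, rfl⟩, Submodule.subset_span (by simp),
      Submodule.subset_span (by simp)⟩, ?_⟩
    rintro l ⟨⟨p, q, hpq, rfl⟩, hx, hy⟩
    exact setOf_rep_mem_span_eq hxy hx hy
  veblen_young := by
    rintro a b c d hab hac - - hbd hcd _ ⟨_, _, -, rfl⟩ _ ⟨_, _, -, rfl⟩ _ ⟨_, _, -, rfl⟩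
      _ ⟨_, _, -, rfl⟩ h1 h2 h3 h4 h5 h6 h7 h8
    rw [setOf_rep_mem_span_eq hab h1 h2, setOf_rep_mem_span_eq hcd h3 h4,
      setOf_rep_mem_span_eq hac h5 h6, setOf_rep_mem_span_eq hbd h7 h8]
    rintro ⟨e, he, he'⟩
    obtain ⟨α, β, h⟩ := Submodule.mem_span_pair.1 he
    obtain ⟨γ, δ, h'⟩ := Submodule.mem_span_pair.1 he'
    have hw : α • a.rep - γ • c.rep = δ • d.rep - β • b.rep := by
      rw [sub_eq_sub_iff_add_eq_add, h, add_comm, h']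
    by_cases h0 : α • a.rep - γ • c.rep = 0
    · have hα := eq_zero_of_smul_eq_smul hac (sub_eq_zero.1 h0)
      have hβ := eq_zero_of_smul_eq_smul hbd (sub_eq_zero.1 (hw.symm.trans h0)).symm
      rw [hα, hβ, zero_smul, zero_smul, add_zero] at h
      exact absurd h.symm e.rep_nonzero
    · obtain ⟨z, k, hz⟩ := exists_smul_rep (K := K) h0
      have hk : k ≠ 0 := fun hk => h0 (by rw [← hz, hk, zero_smul])
      have hz' : z.rep = k⁻¹ • (α • a.rep - γ • c.rep) := by rw [← hz, inv_smul_smul₀ hk]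
      refine ⟨z, ?_, ?_⟩
      · rw [Set.mem_ofPred_eq, hz']
        exact Submodule.smul_mem _ _ (sub_mem
          (Submodule.smul_mem _ _ (Submodule.subset_span (by simp)))
          (Submodule.smul_mem _ _ (Submodule.subset_span (by simp))))
      · rw [Set.mem_ofPred_eq, hz', hw]
        exact Submodule.smul_mem _ _ (sub_mem
          (Submodule.smul_mem _ _ (Submodule.subset_span (by simp)))
          (Submodule.smul_mem _ _ (Submodule.subset_span (by simp))))
  three_points := by
    rintro l ⟨p, q, hpq, rfl⟩
    have h0 : p.rep + q.rep ≠ 0 := fun h => hpq (eq_of_rep_mem_span (by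
      rw [eq_neg_of_add_eq_zero_left h]
      exact neg_mem (Submodule.mem_span_singleton_self _)))
    obtain ⟨z, k, hz⟩ := exists_smul_rep (K := K) h0
    have hk : k ≠ 0 := fun hk => h0 (by rw [← hz, hk, zero_smul])
    refine ⟨p, Submodule.subset_span (by simp), q, Submodule.subset_span (by simp), z, ?_, hpq,
      ?_, ?_⟩
    · rw [Set.mem_ofPred_eq, ← inv_smul_smul₀ hk z.rep, hz]
      exact Submodule.smul_mem _ _ (add_mem (Submodule.subset_span (by simp))
        (Submodule.subset_span (by simp)))
    · rintro rfl
      refine one_ne_zero (eq_zero_of_smul_eq_smul (k := (1 : K)) (l := k - 1) hpq.symm ?_)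
      rw [sub_smul, hz, one_smul, one_smul, add_sub_cancel_left]
    · rintro rfl
      refine one_ne_zero (eq_zero_of_smul_eq_smul (k := (1 : K)) (l := k - 1) hpq ?_)
      rw [sub_smul, hz, one_smul, one_smul, add_sub_cancel_right]

/-- The projective space on a vector space has homogeneous coordinates. -/
noncomputable def coordinatesOfVectorSpace : Coordinates (ofVectorSpace K V) K V where
  vec := Projectivization.rep
  vec_ne_zero := Projectivization.rep_nonzero
  exists_smul_vec _ hv := exists_smul_rep hv
  mem_join_iff x y z := by
    by_cases hxy : x = y
    · subst hxy
      rw [join_self, Set.mem_singleton_iff, Set.pair_eq_singleton]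
      exact ⟨fun h => h ▸ Submodule.mem_span_singleton_self _, eq_of_rep_mem_span⟩
    rw [mem_join_iff_col hxy]
    constructor
    · intro h
      exact h.mem hxy ⟨x, y, hxy, rfl⟩ (Submodule.subset_span (by simp))
        (Submodule.subset_span (by simp))
    · intro h
      exact col_of_mem ⟨x, y, hxy, rfl⟩ (Submodule.subset_span (by simp))
        (Submodule.subset_span (by simp)) h

end Projectivization

namespace Coordinates

variable {P K V : Type*} {S : ProjectiveSpace P} [DivisionRing K] [AddCommGroup V] [Module K V]
  (C : Coordinates S K V)
include C

theorem eq_of_mem_span {x y : P} (h : C.vec y ∈ Submodule.span K {C.vec x}) : y = x := by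
  have := C.mem_join_iff x x y
  rw [join_self, Set.pair_eq_singleton] at this
  exact this.2 h

theorem exists_vec_eq_smul {v : V} (hv : v ≠ 0) : ∃ (x : P) (k : K), k ≠ 0 ∧ C.vec x = k • v := by
  obtain ⟨x, k, hk⟩ := C.exists_smul_vec v hv
  have hk0 : k ≠ 0 := fun h => hv (by rw [← hk, h, zero_smul])
  exact ⟨x, k⁻¹, inv_ne_zero hk0, by rw [← hk, inv_smul_smul₀ hk0]⟩

/-- The least subspace containing a set of points is given by the span of their vectors. -/
theorem mem_span_iff {N : Set P} {z : P} :
    z ∈ S.span N ↔ C.vec z ∈ Submodule.span K (C.vec '' N) := by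
  constructor
  · intro hz
    refine span_subset (T := {z | C.vec z ∈ Submodule.span K (C.vec '' N)})
      (isSubspace_of_col ?_) (fun x hx => Submodule.subset_span ⟨x, hx, rfl⟩) hz
    intro x hx y hy hxy w hw
    have := (C.mem_join_iff x y w).1 ((mem_join_iff_col hxy).2 hw)
    have hle : Submodule.span K {C.vec x, C.vec y} ≤ Submodule.span K (C.vec '' N) := by
      rw [Submodule.span_le, Set.insert_subset_iff, Set.singleton_subset_iff]
      exact ⟨hx, hy⟩
    exact hle this
  · intro hz
    let U : Submodule K V :=
      { carrier := {v | ∀ w, C.vec w ∈ Submodule.span K {v} → w ∈ S.span N}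
        zero_mem' := fun w hw => absurd (by simpa using hw) (C.vec_ne_zero w)
        add_mem' := by
          intro v v' hv hv' w hw
          by_cases h0 : v = 0
          · rw [h0, zero_add] at hw; exact hv' w hw
          by_cases h0' : v' = 0
          · rw [h0', add_zero] at hw; exact hv w hw
          obtain ⟨x, k, hk, hx⟩ := C.exists_vec_eq_smul h0
          obtain ⟨y, l, hl, hy⟩ := C.exists_vec_eq_smul h0'
          have hxN : x ∈ S.span N := hv x (Submodule.mem_span_singleton.2 ⟨k, hx.symm⟩)
          have hyN : y ∈ S.span N := hv' y (Submodule.mem_span_singleton.2 ⟨l, hy.symm⟩)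
          have hw' : w ∈ S.join {x} {y} := by
            rw [C.mem_join_iff]
            refine (Submodule.span_singleton_le_iff_mem _ _).2 ?_ hw
            rw [← inv_smul_smul₀ hk v, ← inv_smul_smul₀ hl v', ← hx, ← hy]
            exact add_mem (Submodule.smul_mem _ _ (Submodule.subset_span (by simp)))
              (Submodule.smul_mem _ _ (Submodule.subset_span (by simp)))
          refine span_subset (isSubspace_span N) ?_ hw'
          rintro _ (rfl | rfl)
          exacts [hxN, hyN]
        smul_mem' := by
          intro k v hv w hw
          refine hv w ((Submodule.span_singleton_le_iff_mem _ _).2 ?_ hw)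
          exact Submodule.smul_mem _ _ (Submodule.mem_span_singleton_self v) }
    have hU : Submodule.span K (C.vec '' N) ≤ U := by
      rw [Submodule.span_le]
      rintro _ ⟨x, hx, rfl⟩ w hw
      rw [C.eq_of_mem_span hw]
      exact subset_span N hx
    exact hU hz z (Submodule.mem_span_singleton_self _)

end Coordinates

/-! ### Weak linear mappings and semilinear maps -/

section WeakLinear

variable {P P' K K' V V' : Type*} {S : ProjectiveSpace P} {S' : ProjectiveSpace P'}
  [DivisionRing K] [AddCommGroup V] [Module K V] [DivisionRing K'] [AddCommGroup V'] [Module K' V']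

theorem mem_image_singleton {φ : P →. P'} {x : P} {y : P'} : y ∈ φ.image {x} ↔ y ∈ φ x := by
  simp [PFun.mem_image]

theorem image_singleton_of_mem {φ : P →. P'} {x : P} {y : P'} (h : y ∈ φ x) :
    φ.image {x} = {y} := by
  ext z
  rw [mem_image_singleton, Set.mem_singleton_iff]
  exact ⟨fun hz => Part.mem_unique hz h, fun hz => hz ▸ h⟩

theorem mem_image {φ : P →. P'} {M : Set P} {y : P'} : y ∈ φ.image M ↔ ∃ x ∈ M, y ∈ φ x :=
  Iff.rfl

theorem IsWeakLinear.col_of_mem {φ : P →. P'} (hφ : S.IsWeakLinear S' φ) {x₁ x₂ x₃ : P}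
    {y₁ y₂ y₃ : P'} (h₁ : y₁ ∈ φ x₁) (h₂ : y₂ ∈ φ x₂) (h₃ : y₃ ∈ φ x₃) (h : S.Col x₁ x₂ x₃) :
    S'.Col y₁ y₂ y₃ := by
  by_cases hy : y₁ = y₂
  · subst hy; exact col_self_left ..
  have hx : x₁ ≠ x₂ := by
    rintro rfl
    exact hy (Part.mem_unique h₁ h₂)
  have := hφ x₁ x₂ hx (mem_image.2 ⟨x₃, (mem_join_iff_col hx).2 h, h₃⟩)
  rw [image_singleton_of_mem h₁, image_singleton_of_mem h₂] at this
  exact (mem_join_iff_col hy).1 this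

/-- A partial mapping of points, on the level of vectors: a representative of a point is sent to the
span of the image of the point, or to the zero subspace if the image is not defined. -/
def pointMap (C : Coordinates S K V) (C' : Coordinates S' K' V') (φ : P →. P') (v : V) :
    Submodule K' V' :=
  Submodule.span K' (C'.vec '' φ.image {x | C.vec x ∈ Submodule.span K {v}})

variable (C : Coordinates S K V) (C' : Coordinates S' K' V') {φ : P →. P'}

theorem pointMap_vec (x : P) :
    pointMap C C' φ (C.vec x) = Submodule.span K' (C'.vec '' φ.image {x}) := by
  have : {y | C.vec y ∈ Submodule.span K {C.vec x}} = {x} := by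
    ext y
    exact ⟨fun h => C.eq_of_mem_span h, fun h => by
      rw [Set.mem_singleton_iff.1 h]; exact Submodule.mem_span_singleton_self _⟩
  rw [pointMap, this]

theorem pointMap_smul {k : K} (hk : k ≠ 0) (v : V) :
    pointMap C C' φ (k • v) = pointMap C C' φ v := by
  rw [pointMap, pointMap, Submodule.span_singleton_smul_eq (IsUnit.mk0 k hk)]

theorem pointMap_zero : pointMap C C' φ 0 = ⊥ := by
  have : {y | C.vec y ∈ Submodule.span K {(0 : V)}} = ∅ := by
    ext y
    simp [C.vec_ne_zero y]
  rw [pointMap, this, Submodule.span_eq_bot]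
  rintro _ ⟨y, ⟨x, hx, -⟩, -⟩
  exact hx.elim

theorem exists_vec_eq_span_image (x : P) :
    ∃ w, Submodule.span K' (C'.vec '' φ.image {x}) = Submodule.span K' {w} := by
  by_cases hx : (φ x).Dom
  · rw [image_singleton_of_mem (Part.get_mem hx), Set.image_singleton]
    exact ⟨_, rfl⟩
  · refine ⟨0, ?_⟩
    rw [Submodule.span_zero_singleton, Submodule.span_eq_bot]
    rintro _ ⟨y, hy, -⟩
    exact absurd (Part.dom_iff_mem.2 ⟨y, mem_image_singleton.1 hy⟩) hx

/-- The case distinction between the zero vector and representatives of points. -/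
theorem Coordinates.vec_induction {p : V → Prop} (h0 : p 0)
    (h : ∀ x (k : K), k ≠ 0 → p (k • C.vec x)) (v : V) : p v := by
  by_cases hv : v = 0
  · rwa [hv]
  · obtain ⟨x, k, hk, hx⟩ := C.exists_vec_eq_smul hv
    have := h x k⁻¹ (inv_ne_zero hk)
    rwa [hx, inv_smul_smul₀ hk] at this

theorem isProjectiveMap_pointMap (hφ : S.IsWeakLinear S' φ) (htri : S'.ContainsTriangle φ.ran) :
    IsProjectiveMap (K := K) (pointMap C C' φ) := by
  have hspan : ∀ v, ∃ w, pointMap C C' φ v = Submodule.span K' {w} := by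
    refine C.vec_induction ⟨0, by rw [pointMap_zero, Submodule.span_zero_singleton]⟩ ?_
    intro x k hk
    rw [pointMap_smul C C' hk, pointMap_vec]
    exact exists_vec_eq_span_image C' x
  refine ⟨hspan, fun k v hk => pointMap_smul C C' hk v, ?_, ?_⟩
  · intro v w
    by_cases hvw : v + w = 0
    · rw [hvw, pointMap_zero]; exact bot_le
    by_cases hv : v = 0
    · rw [hv, zero_add]; exact le_sup_right
    by_cases hw : w = 0
    · rw [hw, add_zero]; exact le_sup_left
    obtain ⟨x, k, hk, hx⟩ := C.exists_vec_eq_smul hv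
    obtain ⟨y, l, hl, hy⟩ := C.exists_vec_eq_smul hw
    obtain ⟨z, m, hm, hz⟩ := C.exists_vec_eq_smul hvw
    rw [← pointMap_smul C C' hk v, ← pointMap_smul C C' hl w, ← pointMap_smul C C' hm (v + w),
      ← hx, ← hy, ← hz]
    have hzxy : z ∈ S.join {x} {y} := by
      rw [C.mem_join_iff, hz, ← inv_smul_smul₀ hk v, ← inv_smul_smul₀ hl w, ← hx, ← hy]
      exact Submodule.smul_mem _ _ (add_mem
        (Submodule.smul_mem _ _ (Submodule.subset_span (by simp)))
        (Submodule.smul_mem _ _ (Submodule.subset_span (by simp))))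
    by_cases hxy : x = y
    · subst hxy
      rw [join_self, Set.mem_singleton_iff] at hzxy
      rw [hzxy]; exact le_sup_left
    · rw [pointMap_vec, pointMap_vec, pointMap_vec, ← Submodule.span_union, ← Set.image_union,
        Submodule.span_le]
      rintro _ ⟨p, hp, rfl⟩
      rw [mem_image_singleton] at hp
      exact C'.mem_span_iff.1 (hφ x y hxy (mem_image.2 ⟨z, hzxy, hp⟩))
  · intro v w
    by_contra! hcon
    obtain ⟨v', hv'⟩ := hspan v
    obtain ⟨w', hw'⟩ := hspan w
    rw [hv', hw', ← Submodule.span_union, Set.singleton_union] at hcon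
    have hmem : ∀ p ∈ φ.ran, C'.vec p ∈ Submodule.span K' {v', w'} := by
      rintro p ⟨x, hx⟩
      refine hcon (C.vec x) ?_
      rw [pointMap_vec, image_singleton_of_mem hx]
      exact Submodule.subset_span (by simp)
    obtain ⟨p, hp, q, hq, r, hr, h⟩ := htri
    refine h ?_
    by_cases hpq : p = q
    · subst hpq; exact col_self_left ..
    refine (mem_join_iff_col hpq).1 ((C'.mem_join_iff p q r).2 ?_)
    exact span_pair_le_span_pair (hmem p hp) (hmem q hq) (C'.vec_ne_zero p)
      (fun e => hpq (C'.eq_of_mem_span e).symm) (hmem r hr)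

/-- The fundamental theorem: a weak linear mapping whose image contains a triangle comes from a
semilinear map. -/
theorem IsWeakLinear.exists_semilinearMap (hφ : S.IsWeakLinear S' φ)
    (htri : S'.ContainsTriangle φ.ran) :
    ∃ (σ : K →+* K') (F : V →ₛₗ[σ] V'),
      ∀ x y, y ∈ φ x ↔ F (C.vec x) ≠ 0 ∧ C'.vec y ∈ Submodule.span K' {F (C.vec x)} := by
  obtain ⟨σ, F, hF⟩ := (isProjectiveMap_pointMap C C' hφ htri).exists_semilinearMap
  refine ⟨σ, F, fun x y => ?_⟩
  have hx := hF (C.vec x)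
  rw [pointMap_vec] at hx
  constructor
  · intro h
    have hy : C'.vec y ∈ Submodule.span K' {F (C.vec x)} := by
      rw [← hx, image_singleton_of_mem h]
      exact Submodule.subset_span (by simp)
    refine ⟨fun h0 => C'.vec_ne_zero y ?_, hy⟩
    rwa [h0, Submodule.span_zero_singleton, Submodule.mem_bot] at hy
  · rintro ⟨h0, hy⟩
    by_cases hdom : (φ x).Dom
    · obtain ⟨z, hz⟩ := Part.dom_iff_mem.1 hdom
      rw [← hx, image_singleton_of_mem hz, Set.image_singleton] at hy
      rwa [C'.eq_of_mem_span hy]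
    · refine absurd ?_ h0
      have : Submodule.span K' (C'.vec '' φ.image {x}) = ⊥ := by
        rw [Submodule.span_eq_bot]
        rintro _ ⟨y, hy, -⟩
        exact absurd (Part.dom_iff_mem.2 ⟨y, mem_image_singleton.1 hy⟩) hdom
      rwa [this, eq_comm, Submodule.span_singleton_eq_bot] at hx

end WeakLinear

/-! ### Linear mappings from linear maps, and extension of scalars -/

section Factorization

variable {P P' K V V' : Type*} {S : ProjectiveSpace P} {S' : ProjectiveSpace P'}
  [DivisionRing K] [AddCommGroup V] [Module K V] [AddCommGroup V'] [Module K V']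

/-- The partial mapping of points that comes from a linear map; a point is outside the domain if its
vector is in the kernel. -/
noncomputable def ofLinearMap (C : Coordinates S K V) (C' : Coordinates S' K V') (f : V →ₗ[K] V') :
    P →. P' :=
  fun x => ⟨f (C.vec x) ≠ 0, fun h => (C'.exists_vec_eq_smul h).choose⟩

variable (C : Coordinates S K V) (C' : Coordinates S' K V') (f : V →ₗ[K] V')

theorem mem_ofLinearMap_iff {x : P} {y : P'} : y ∈ ofLinearMap C C' f x ↔
    f (C.vec x) ≠ 0 ∧ C'.vec y ∈ Submodule.span K {f (C.vec x)} := by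
  have key : ∀ h : f (C.vec x) ≠ 0, ∃ k : K, k ≠ 0 ∧
      C'.vec ((ofLinearMap C C' f x).get h) = k • f (C.vec x) :=
    fun h => (C'.exists_vec_eq_smul h).choose_spec
  constructor
  · rintro ⟨h, rfl⟩
    obtain ⟨k, -, hk⟩ := key h
    exact ⟨h, by rw [hk]; exact Submodule.smul_mem _ _ (Submodule.mem_span_singleton_self _)⟩
  · rintro ⟨h, hy⟩
    obtain ⟨k, hk0, hk⟩ := key h
    refine ⟨h, (C'.eq_of_mem_span ?_).symm⟩
    rwa [hk, Submodule.span_singleton_smul_eq (IsUnit.mk0 k hk0)]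

theorem span_image_ofLinearMap (x : P) :
    Submodule.span K (C'.vec '' (ofLinearMap C C' f).image {x}) =
      Submodule.span K {f (C.vec x)} := by
  by_cases h : f (C.vec x) = 0
  · rw [h, Submodule.span_zero_singleton, Submodule.span_eq_bot]
    rintro _ ⟨y, hy, -⟩
    exact absurd h ((mem_ofLinearMap_iff C C' f).1 (mem_image_singleton.1 hy)).1
  · obtain ⟨y, k, hk0, hk⟩ := C'.exists_vec_eq_smul h
    have hy : y ∈ ofLinearMap C C' f x := by
      rw [mem_ofLinearMap_iff, hk]
      exact ⟨h, Submodule.smul_mem _ _ (Submodule.mem_span_singleton_self _)⟩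
    rw [image_singleton_of_mem hy, Set.image_singleton, hk,
      Submodule.span_singleton_smul_eq (IsUnit.mk0 k hk0)]

theorem isLinear_ofLinearMap : S.IsLinear S' (ofLinearMap C C' f) where
  image_join x y hxy := by
    ext z
    change z ∈ PFun.image _ _ ↔ z ∈ S'.span (_ ∪ _)
    rw [mem_image, C'.mem_span_iff, Set.image_union, Submodule.span_union,
      span_image_ofLinearMap, span_image_ofLinearMap, ← Submodule.span_union, Set.singleton_union]
    have himage : Submodule.span K {f (C.vec x), f (C.vec y)} =
        (Submodule.span K {C.vec x, C.vec y}).map f := by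
      rw [Submodule.map_span, Set.image_pair]
    rw [himage]
    constructor
    · rintro ⟨w, hw, hz⟩
      rw [C.mem_join_iff] at hw
      refine (Submodule.span_singleton_le_iff_mem _ _).2 ?_ ((mem_ofLinearMap_iff C C' f).1 hz).2
      exact Submodule.mem_map_of_mem hw
    · rintro ⟨v, hv, hvz⟩
      have hv0 : v ≠ 0 := by
        rintro rfl
        exact C'.vec_ne_zero z (by rw [← hvz, map_zero])
      obtain ⟨w, k, hk0, hk⟩ := C.exists_vec_eq_smul hv0
      refine ⟨w, ?_, ?_⟩
      · rw [C.mem_join_iff, hk]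
        exact Submodule.smul_mem _ _ hv
      · rw [mem_ofLinearMap_iff, hk, map_smul, hvz,
          Submodule.span_singleton_smul_eq (IsUnit.mk0 k hk0)]
        exact ⟨smul_ne_zero hk0 (C'.vec_ne_zero z), Submodule.mem_span_singleton_self _⟩
  exists_exceptional x hx y hy hxy he := by
    obtain ⟨p, hp⟩ := Part.dom_iff_mem.1 hx
    have hq := he ▸ hp
    rw [mem_ofLinearMap_iff, Submodule.mem_span_singleton] at hp hq
    obtain ⟨-, k, hk⟩ := hp
    obtain ⟨-, l, hl⟩ := hq
    have hk0 : k ≠ 0 := by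
      rintro rfl
      exact C'.vec_ne_zero p (by rw [← hk, zero_smul])
    have h0 : k • C.vec x - l • C.vec y ≠ 0 := fun h => hxy <| by
      refine C.eq_of_mem_span (Submodule.mem_span_singleton.2 ⟨k⁻¹ * l, ?_⟩)
      rw [mul_smul, ← sub_eq_zero.1 h, inv_smul_smul₀ hk0]
    obtain ⟨z, m, -, hz⟩ := C.exists_vec_eq_smul h0
    refine ⟨z, ?_, fun hdom => ?_⟩
    · rw [C.mem_join_iff, hz]
      exact Submodule.smul_mem _ _ (sub_mem
        (Submodule.smul_mem _ _ (Submodule.subset_span (by simp)))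
        (Submodule.smul_mem _ _ (Submodule.subset_span (by simp))))
    · refine hdom ?_
      rw [hz, map_smul, map_sub, map_smul, map_smul, hk, hl, sub_self, smul_zero]

end Factorization

/-- A mapping that preserves and reflects spans is a strong embedding. -/
theorem isStrongEmbedding_of_mem_span_iff {P P'' : Type*} {S : ProjectiveSpace P}
    {S'' : ProjectiveSpace P''} {ι : P → P''}
    (h : ∀ (N : Set P) x, ι x ∈ S''.span (ι '' N) ↔ x ∈ S.span N) :
    S.IsStrongEmbedding S'' ι := by
  have hinj : Function.Injective ι := by
    intro x y hxy
    have := (h {y} x).1 (subset_span _ ⟨y, rfl, hxy.symm⟩)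
    rw [← Set.union_self {y}] at this
    exact (join_self (S := S) y).le this
  have hcol : ∀ x y z, S.Col x y z ↔ S''.Col (ι x) (ι y) (ι z) := by
    intro x y z
    by_cases hxy : x = y
    · subst hxy
      exact ⟨fun _ => col_self_left .., fun _ => col_self_left ..⟩
    rw [← mem_join_iff_col hxy, ← mem_join_iff_col (hinj.ne hxy), join, join,
      ← h ({x} ∪ {y}) z, Set.image_union, Set.image_singleton, Set.image_singleton]
  refine ⟨⟨hinj, fun x y z => (hcol x y z).1, fun x y z => mt (hcol x y z).2⟩, ?_⟩
  rintro M hM _ ⟨x, hx, rfl⟩ hspan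
  rw [← Set.image_singleton, ← Set.image_sdiff hinj, h] at hspan
  exact hM x hx hspan

section ExtensionOfScalars

variable {K K' V I : Type*} [DivisionRing K] [DivisionRing K'] [AddCommGroup V] [Module K V]

/-- The extension of scalars of a vector space with a basis, in coordinates. -/
noncomputable def extendScalars (σ : K →+* K') (b : Module.Basis I K V) : V →ₛₗ[σ] (I →₀ K') where
  toFun v := (b.repr v).mapRange σ (map_zero σ)
  map_add' v w := by ext; simp
  map_smul' k v := by ext; simp

/-- A semilinear map is linear on the extension of scalars. -/
theorem linearCombination_extendScalars {M : Type*} [AddCommGroup M] [Module K' M] {σ : K →+* K'}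
    (b : Module.Basis I K V) (G : V →ₛₗ[σ] M) (v : V) :
    Finsupp.linearCombination K' (G ∘ b) (extendScalars σ b v) = G v := by
  conv_rhs => rw [← b.linearCombination_repr v]
  rw [Finsupp.linearCombination_apply, Finsupp.linearCombination_apply, map_finsuppSum]
  refine (Finsupp.sum_mapRange_index (hf := map_zero σ) fun i => zero_smul K' (G (b i))).trans ?_
  simp

/-- Extension of scalars preserves linear independence, since linear functionals extend. -/
theorem extendScalars_mem_span_iff (σ : K →+* K') (b : Module.Basis I K V) (N : Set V) (v : V) :
    extendScalars σ b v ∈ Submodule.span K' (extendScalars σ b '' N) ↔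
      v ∈ Submodule.span K N := by
  constructor
  · contrapose
    intro hv h
    obtain ⟨l, hl, hN⟩ := Submodule.exists_le_ker_of_notMem hv
    let G : V →ₛₗ[σ] K' :=
      { toFun := fun w => σ (l w)
        map_add' := fun _ _ => by rw [l.map_add, map_add]
        map_smul' := fun _ _ => by rw [l.map_smul, smul_eq_mul, map_mul, smul_eq_mul] }
    have hle : Submodule.span K' (extendScalars σ b '' N) ≤
        LinearMap.ker (Finsupp.linearCombination K' (G ∘ b)) := by
      rw [Submodule.span_le]
      rintro _ ⟨w, hw, rfl⟩
      rw [SetLike.mem_coe, LinearMap.mem_ker, linearCombination_extendScalars]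
      change σ (l w) = 0
      rw [LinearMap.mem_ker.1 (hN (Submodule.subset_span hw)), map_zero]
    have := LinearMap.mem_ker.1 (hle h)
    rw [linearCombination_extendScalars] at this
    exact hl ((map_eq_zero σ).1 this)
  · intro h
    induction h using Submodule.span_induction with
    | mem x hx => exact Submodule.subset_span ⟨x, hx, rfl⟩
    | zero => rw [map_zero]; exact zero_mem _
    | add x y _ _ hx hy => rw [map_add]; exact add_mem hx hy
    | smul k x _ hx => rw [LinearMap.map_smulₛₗ]; exact Submodule.smul_mem _ _ hx

end ExtensionOfScalars

end ProjectiveSpace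

theorem corollary2 {P : Type u} {P' : Type v} (S : ProjectiveSpace P) (S' : ProjectiveSpace P')
    (hS : S.IsDesarguesian) (hS' : S'.IsDesarguesian)
    (φ : P →. P') (hφ : ProjectiveSpace.IsWeakLinear S S' φ)
    (htri : S'.ContainsTriangle φ.ran) :
    ∃ (P'' : Type (max u v)) (S'' : ProjectiveSpace P'') (ι : P → P'') (ψ : P'' →. P'),
      ProjectiveSpace.IsStrongEmbedding S S'' ι ∧
      ProjectiveSpace.IsLinear S'' S' ψ ∧
      ∀ x : P, φ x = ψ (ι x) := by
  obtain ⟨y₁, ⟨x₁, h₁⟩, y₂, ⟨x₂, h₂⟩, y₃, ⟨x₃, h₃⟩, hy⟩ := id htri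
  obtain ⟨K, V, _, _, _, ⟨C⟩⟩ := ProjectiveSpace.exists_coordinates hS
    ⟨x₁, x₂, x₃, fun h => hy (hφ.col_of_mem h₁ h₂ h₃ h)⟩
  obtain ⟨K', V', _, _, _, ⟨C'⟩⟩ := ProjectiveSpace.exists_coordinates hS' ⟨y₁, y₂, y₃, hy⟩
  obtain ⟨σ, F, hF⟩ := hφ.exists_semilinearMap C C' htri
  let b := Module.Basis.ofVectorSpace K V
  let C'' := ProjectiveSpace.coordinatesOfVectorSpace K' (Module.Basis.ofVectorSpaceIndex K V →₀ K')
  have hj : ∀ x, ProjectiveSpace.extendScalars σ b (C.vec x) ≠ 0 := by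
    intro x h
    have := (ProjectiveSpace.extendScalars_mem_span_iff σ b ∅ (C.vec x)).1 (h ▸ zero_mem _)
    rw [Submodule.span_empty, Submodule.mem_bot] at this
    exact C.vec_ne_zero x this
  choose ι k hk hι using fun x => C''.exists_vec_eq_smul (hj x)
  -- `C''.vec (ι x)` is the vector of `x` with extended scalars, up to a factor `k x`.
  let f := Finsupp.linearCombination K' (F ∘ b)
  have hspan : ∀ N : Set P, Submodule.span K' (C''.vec '' (ι '' N)) =
      Submodule.span K' (ProjectiveSpace.extendScalars σ b '' (C.vec '' N)) := by
    intro N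
    apply le_antisymm
    · rw [Submodule.span_le]
      rintro _ ⟨_, ⟨x, hx, rfl⟩, rfl⟩
      rw [hι]
      exact Submodule.smul_mem _ _ (Submodule.subset_span ⟨_, ⟨x, hx, rfl⟩, rfl⟩)
    · rw [Submodule.span_le]
      rintro _ ⟨_, ⟨x, hx, rfl⟩, rfl⟩
      rw [← inv_smul_smul₀ (hk x) (ProjectiveSpace.extendScalars σ b (C.vec x)), ← hι]
      exact Submodule.smul_mem _ _ (Submodule.subset_span ⟨_, ⟨x, hx, rfl⟩, rfl⟩)
  refine ⟨_, ProjectiveSpace.ofVectorSpace K' (Module.Basis.ofVectorSpaceIndex K V →₀ K'), ι,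
    ProjectiveSpace.ofLinearMap C'' C' f,
    ProjectiveSpace.isStrongEmbedding_of_mem_span_iff fun N x => ?_,
    ProjectiveSpace.isLinear_ofLinearMap C'' C' f, fun x => ?_⟩
  · rw [C''.mem_span_iff, C.mem_span_iff, hspan, hι, Submodule.smul_mem_iff _ (hk x),
      ProjectiveSpace.extendScalars_mem_span_iff]
  · ext y
    rw [hF, ProjectiveSpace.mem_ofLinearMap_iff, hι, map_smul,
      ProjectiveSpace.linearCombination_extendScalars,
      Submodule.span_singleton_smul_eq (IsUnit.mk0 _ (hk x)), ne_eq, ne_eq,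
      smul_eq_zero_iff_right (hk x)]
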